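/- **Model.** Fix $n\ge 1$ processes $\Pi=\{p_1,\dots,p_n\}$ and a simple undirected graph $G=(\Pi,E)$; let $N^+(p_i)$ consist of $p_i$ and its neighbours in $G$. The uniform m&m (message-and-memory) system $\mathcal S_G$ induced by $G$ is the asynchronous system with processes $\Pi$ in which (i) every process can send messages to every process over reliable asynchronous links, and (ii) for every $i$ and every $p\in N^+(p_i)$ there is an atomic single-writer multi-reader (SWMR) register $R_i[p]$ that can be written by $p$ and read by the processes in $N^+(p_i)$, and only by them. A process crashes if it takes only finitely many steps. An algorithm implements, with at most $t$ crashes, an atomic SWMR register writable by $w\in\Pi$, readable by all processes, with initial value $v_0$, if in every run in which at most $t$ processes crash, each process executes its operations one after the other, and $w$ (the only writer) writes pairwise distinct values different from $v_0$, the following hold, where $v_k$ ($k\ge1$) is the value of the $k$-th write, and an operation precedes another one if it completes before the other one starts, and two operations are concurrent if neither precedes the other one: * every operation called by a process that does not crash completes; * if a read $r$ returns $v$, then either some write of $v$ is concurrent with $r$ or immediately precedes $r$ (it precedes $r$, and no write is preceded by it and precedes $r$), or no write precedes $r$ and $v=v_0$; * if a read that returns $v_k$ precedes a read that returns $v_{k'}$,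 then $k\le k'$. **Thresholds.** Let $G^2=(\Pi,E')$, where $(u,v)\in E'$ if $(u,v)\in E$ or $(u,k),(k,v)\in E$ for some $k\in\Pi$. Let $t_G$ be the largest $t\le n$ such that for all $P,P'\subseteq\Pi$ of size $n-t$ each, $P\cap P'\neq\emptyset$ or $G^2$ has an edge $(u,v)$ with $u\in P$ and $v\in P'$. Let $t_L$ be the largest $t\le n$ such that for all $P,P'\subseteq\Pi$ of size $n-t$ each, $P\cap P'\ne\emptyset$ or some set $N^+(p_i)$ contains both a process in $P$ and a process in $P'$. **Theorem 5.** $t_G=t_L$, and: * If at most $t_G$ processes may crash in $\mathcal S_G$ (that is, for every $t\le t_G$ and at most $t$ crashes), then for every process $w$ it is possible to implement in $\mathcal S_G$ an atomic SWMR register writable by $w$ and readable by all processes, with any set of values and any initial value. * If more than $t_G$ processes may crash in $\mathcal S_G$ (that is, for every $t>t_G$ and at most $t$ crashes), and $t_G<n-1$, then for some process $w$ it is impossible to implement in $\mathcal S_G$ an atomic SWMR register writable by $w$ and readable by all processes, whatever its set of at least two values and its initial value. -/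

import Mathlib

universe u

namespace MM

/-! ### The thresholds -/

/-- The largest `t ≤ n` such that any two sets `P`, `P'` of `n - t` processes each either intersect,
or contain a process `u ∈ P` and a process `v ∈ P'` with `rel u v`. -/
noncomputable def maxResilience {n : ℕ} (rel : Fin n → Fin n → Prop) : ℕ :=
  sSup {t : ℕ | t ≤ n ∧ ∀ P P' : Finset (Fin n), P.card = n - t → P'.card = n - t →
    (P ∩ P').Nonempty ∨ ∃ u ∈ P, ∃ v ∈ P', rel u v}

/-- For at least one process, the maximum in `maxResilience` is attained. -/
theorem isGreatest_maxResilience {n : ℕ} (hn : 0 < n) (rel : Fin n → Fin n → Prop) :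
    IsGreatest {t : ℕ | t ≤ n ∧ ∀ P P' : Finset (Fin n), P.card = n - t → P'.card = n - t →
      (P ∩ P').Nonempty ∨ ∃ u ∈ P, ∃ v ∈ P', rel u v} (maxResilience rel) := by
  have hb : BddAbove {t : ℕ | t ≤ n ∧ ∀ P P' : Finset (Fin n), P.card = n - t → P'.card = n - t →
      (P ∩ P').Nonempty ∨ ∃ u ∈ P, ∃ v ∈ P', rel u v} := ⟨n, fun t ht => ht.1⟩
  refine ⟨Nat.sSup_mem ⟨0, Nat.zero_le _, fun P P' hP hP' => Or.inl ?_⟩ hb,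
    fun t ht => le_csSup hb ht⟩
  have h1 : P = Finset.univ := by
    apply Finset.eq_univ_of_card; simpa using hP
  have h2 : P' = Finset.univ := by
    apply Finset.eq_univ_of_card; simpa using hP'
  subst h1 h2
  exact ⟨⟨0, hn⟩, by simp⟩

/-- `t_L` for the bag `L = (S i)` of sets of processes. -/
noncomputable def tL {n m : ℕ} (S : Fin m → Set (Fin n)) : ℕ :=
  maxResilience fun u v => ∃ i, u ∈ S i ∧ v ∈ S i

/-- `(u, v)` is an edge of the square `G²` of the graph `G`. -/
def SquareAdj {n : ℕ} (G : SimpleGraph (Fin n)) (u v : Fin n) : Prop :=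
  G.Adj u v ∨ ∃ k, G.Adj u k ∧ G.Adj k v

/-- `t_G` for the graph `G`. -/
noncomputable def tG {n : ℕ} (G : SimpleGraph (Fin n)) : ℕ :=
  maxResilience (SquareAdj G)

/-- The bag `(N⁺(p_i))_i` of closed neighbourhoods of `G`. The uniform m&m system induced by `G` is
the m&m system induced by this bag. -/
def closedNbhd {n : ℕ} (G : SimpleGraph (Fin n)) (i : Fin n) : Set (Fin n) :=
  insert i (G.neighborSet i)

/-! ### The m&m system induced by a bag `S` of sets of processes, and its algorithms -/

/-- The shared registers: a register `R_i[p]` for every `i` and every `p ∈ S i`. The register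
`R_i[p]` can be written by `p` only, and read by the processes in `S i` only. -/
abbrev Reg {n m : ℕ} (S : Fin m → Set (Fin n)) : Type :=
  {x : Fin m × Fin n // x.2 ∈ S x.1}

/-- The operations on the implemented register, whose values are in `V`. -/
inductive Op (V : Type u) : Type u
  | read : Op V
  | write (v : V) : Op V

/-- The steps that an algorithm can prescribe to process `p`, with the state of `p` afterwards:
* send a message to a process (possibly itself);
* try to receive a message: the outcome is `none`, or a message together with its sender;
* read a register that `p` may read;
* write a register that `p` may write;
* return from the current operation on the implemented register (the returned value matters only
  if that operation is a read; it is an acknowledgement if it is a write). -/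
inductive Action {n m : ℕ} (S : Fin m → Set (Fin n)) (V State Msg Val : Type u) (p : Fin n) :
    Type u
  | send (q : Fin n) (a : Msg) (next : State)
  | recv (next : Option (Fin n × Msg) → State)
  | read (R : Reg S) (h : p ∈ S R.1.1) (next : Val → State)
  | write (i : Fin m) (h : p ∈ S i) (x : Val) (next : State)
  | ret (v : V) (next : State)

/-- A (deterministic) algorithm for the m&m system induced by `S` that implements a register with
values in `V`: every process is an automaton, whose state determines its next step. -/
structure Algorithm {n m : ℕ} (S : Fin m → Set (Fin n)) (V : Type u) : Type (u + 1) where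
  /-- local states -/
  State : Type u
  /-- contents of messages -/
  Msg : Type u
  /-- contents of shared registers -/
  Val : Type u
  /-- initial state of each process -/
  init : Fin n → State
  /-- initial value of each shared register -/
  regInit : Reg S → Val
  /-- the state of a process after an operation on the implemented register is called -/
  call : (p : Fin n) → Op V → State → State
  /-- the next step of a process -/
  act : (p : Fin n) → State → Action S V State Msg Val p

/-- A configuration: the state of each process, whether it is executing an operation on the
implemented register, the messages `(sender, receiver, content)` that are sent but not yet received,
and the value of each shared register. -/
structure Config {n m : ℕ} {S : Fin m → Set (Fin n)} {V : Type u} (A : Algorithm S V) :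
    Type u where
  state : Fin n → A.State
  busy : Fin n → Bool
  net : Multiset (Fin n × Fin n × A.Msg)
  regs : Reg S → A.Val

/-- The initial configuration. -/
def Config.initial {n m : ℕ} {S : Fin m → Set (Fin n)} {V : Type u} (A : Algorithm S V) :
    Config A where
  state := A.init
  busy := fun _ => false
  net := 0
  regs := A.regInit

/-- What happens at an instant of time. -/
inductive Event (n : ℕ) (V Msg : Type u) : Type u
  /-- nothing -/
  | idle : Event n V Msg
  /-- an operation is called at process `p` -/
  | call (p : Fin n) (op : Op V) : Event n V Msg
  /-- `p` sends a message, or accesses a shared register -/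
  | internal (p : Fin n) : Event n V Msg
  /-- `p` tries to receive a message, with this outcome -/
  | recv (p : Fin n) (o : Option (Fin n × Msg)) : Event n V Msg
  /-- `p` returns from an operation -/
  | ret (p : Fin n) (v : V) : Event n V Msg

/-- The event is a step of process `p`. -/
def Event.IsStepOf {n : ℕ} {V Msg : Type u} (p : Fin n) : Event n V Msg → Prop
  | .idle => False
  | .call _ _ => False
  | .internal q => q = p
  | .recv q _ => q = p
  | .ret q _ => q = p

/-- The transitions of an algorithm, where `w` is the writer of the implemented register. Operations
are called at arbitrary times, but each process executes its operations one after the other, and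
only `w` writes. Messages are received in an arbitrary order, after an arbitrary delay. -/
inductive Step {n m : ℕ} {S : Fin m → Set (Fin n)} {V : Type u} (A : Algorithm S V) (w : Fin n) :
    Config A → Event n V A.Msg → Config A → Prop
  | idle (C : Config A) : Step A w C .idle C
  | call (C : Config A) (p : Fin n) (op : Op V)
      (hw : ∀ v, op = .write v → p = w) (hb : C.busy p = false) :
      Step A w C (.call p op)
        { C with
          state := Function.update C.state p (A.call p op (C.state p))
          busy := Function.update C.busy p true }
  | send (C : Config A) (p q : Fin n) (a : A.Msg) (s : A.State)
      (h : A.act p (C.state p) = .send q a s) :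
      Step A w C (.internal p)
        { C with
          state := Function.update C.state p s
          net := (p, q, a) ::ₘ C.net }
  | recvNone (C : Config A) (p : Fin n) (k : Option (Fin n × A.Msg) → A.State)
      (h : A.act p (C.state p) = .recv k) :
      Step A w C (.recv p none)
        { C with state := Function.update C.state p (k none) }
  | recvSome (C : Config A) (p q : Fin n) (a : A.Msg) (net' : Multiset (Fin n × Fin n × A.Msg))
      (k : Option (Fin n × A.Msg) → A.State)
      (h : A.act p (C.state p) = .recv k) (hnet : C.net = (q, p, a) ::ₘ net') :
      Step A w C (.recv p (some (q, a)))
        { C with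
          state := Function.update C.state p (k (some (q, a)))
          net := net' }
  | read (C : Config A) (p : Fin n) (R : Reg S) (hp : p ∈ S R.1.1) (k : A.Val → A.State)
      (h : A.act p (C.state p) = .read R hp k) :
      Step A w C (.internal p)
        { C with state := Function.update C.state p (k (C.regs R)) }
  | write (C : Config A) (p : Fin n) (i : Fin m) (hp : p ∈ S i) (x : A.Val) (s : A.State)
      (h : A.act p (C.state p) = .write i hp x s) :
      Step A w C (.internal p)
        { C with
          state := Function.update C.state p s
          regs := Function.update C.regs ⟨(i, p), hp⟩ x }
  | ret (C : Config A) (p : Fin n) (v : V) (s : A.State)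
      (h : A.act p (C.state p) = .ret v s) :
      Step A w C (.ret p v)
        { C with
          state := Function.update C.state p s
          busy := Function.update C.busy p false }

/-- A run of the algorithm: an infinite sequence of transitions from the initial configuration. -/
structure Run {n m : ℕ} {S : Fin m → Set (Fin n)} {V : Type u} (A : Algorithm S V) (w : Fin n) :
    Type u where
  cfg : ℕ → Config A
  ev : ℕ → Event n V A.Msg
  cfg_zero : cfg 0 = Config.initial A
  step : ∀ k, Step A w (cfg k) (ev k) (cfg (k + 1))

namespace Run

variable {n m : ℕ} {S : Fin m → Set (Fin n)} {V : Type u} {A : Algorithm S V} {w : Fin n}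

/-- Process `p` does not crash: it takes infinitely many steps. -/
def Correct (r : Run A w) (p : Fin n) : Prop :=
  ∀ k, ∃ k' ≥ k, (r.ev k').IsStepOf p

/-- The set of processes that crash. -/
def crashed (r : Run A w) : Set (Fin n) := {p | ¬ r.Correct p}

/-- The links are reliable: a process that tries to receive messages again and again eventually
receives every message that was sent to it. -/
def ReliableLinks (r : Run A w) : Prop :=
  ∀ q, (∀ k, ∃ k' ≥ k, ∃ o, r.ev k' = .recv q o) →
    ∀ k p a, (p, q, a) ∈ (r.cfg k).net → ∃ k' ≥ k, r.ev k' = .recv q (some (p, a))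

/-- The written values are pairwise distinct, and different from the initial value `v₀`. -/
def DistinctWrites (r : Run A w) (v₀ : V) : Prop :=
  ∀ s p v, r.ev s = .call p (.write v) →
    v ≠ v₀ ∧ ∀ s' p', r.ev s' = .call p' (.write v) → s' = s

/-! An operation of a run is identified with the time `s` at which it starts. -/

/-- A read operation starts at time `s`. -/
def IsRead (r : Run A w) (s : ℕ) : Prop := ∃ p, r.ev s = .call p .read

/-- An operation that writes `v` starts at time `s`. -/
def IsWrite (r : Run A w) (s : ℕ) (v : V) : Prop := ∃ p, r.ev s = .call p (.write v)

/-- The operation that starts at time `s` completes at time `f`, and returns `v`. -/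
def Returns (r : Run A w) (s f : ℕ) (v : V) : Prop :=
  ∃ p op, r.ev s = .call p op ∧ s < f ∧ r.ev f = .ret p v ∧
    ∀ j, s < j → j < f → ∀ v', r.ev j ≠ .ret p v'

/-- The operation that starts at `s` completes before the operation that starts at `s'` starts. -/
def Precedes (r : Run A w) (s s' : ℕ) : Prop := ∃ f v, r.Returns s f v ∧ f < s'

/-- Neither operation precedes the other one. -/
def Concurrent (r : Run A w) (s s' : ℕ) : Prop := ¬ r.Precedes s s' ∧ ¬ r.Precedes s' s

/-- The write that starts at `s` immediately precedes the read that starts at `s'`. -/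
def ImmediatelyPrecedes (r : Run A w) (s s' : ℕ) : Prop :=
  r.Precedes s s' ∧ ¬ ∃ o v, r.IsWrite o v ∧ r.Precedes s o ∧ r.Precedes o s'

/-- `v = v_k`: `v` is the initial value if `k = 0`, and the value of the `k`-th write if `k ≥ 1`. -/
def IsValue (r : Run A w) (v₀ : V) (k : ℕ) (v : V) : Prop :=
  (k = 0 ∧ v = v₀) ∨ ∃ s, r.IsWrite s v ∧ k = {s' : ℕ | s' ≤ s ∧ ∃ v', r.IsWrite s' v'}.ncard

/-- First property of atomic registers: a read that returns `v` either has a write of `v` that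
immediately precedes it or is concurrent with it, or no write precedes it and `v` is the initial
value. -/
def Property1 (r : Run A w) (v₀ : V) : Prop :=
  ∀ s f v, r.IsRead s → r.Returns s f v →
    (∃ s', r.IsWrite s' v ∧ (r.ImmediatelyPrecedes s' s ∨ r.Concurrent s' s)) ∨
    ((¬ ∃ s' v', r.IsWrite s' v' ∧ r.Precedes s' s) ∧ v = v₀)

/-- Second property of atomic registers: if a read that returns `v_k` precedes a read that returns
`v_k'`, then `k ≤ k'`. -/
def Property2 (r : Run A w) (v₀ : V) : Prop :=
  ∀ s f v s' f' v' k k', r.IsRead s → r.Returns s f v → r.IsRead s' → r.Returns s' f' v' →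
    r.IsValue v₀ k v → r.IsValue v₀ k' v' → r.Precedes s s' → k ≤ k'

/-- Every operation called at a process that does not crash completes. -/
def Live (r : Run A w) : Prop :=
  ∀ s p op, r.ev s = .call p op → r.Correct p → ∃ f v, r.Returns s f v

end Run

/-- The algorithm implements an atomic register with initial value `v₀`, writable by `w` and
readable by all processes, in every run in which at most `t` processes crash. -/
def Algorithm.Implements {n m : ℕ} {S : Fin m → Set (Fin n)} {V : Type u} (A : Algorithm S V)
    (t : ℕ) (w : Fin n) (v₀ : V) : Prop :=
  ∀ r : Run A w, r.ReliableLinks → r.DistinctWrites v₀ → r.crashed.ncard ≤ t →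
    r.Property1 v₀ ∧ r.Property2 v₀ ∧ r.Live

/-- In the m&m system induced by `S`, it is possible to implement an atomic register with initial
value `v₀`, writable by `w` and readable by all processes, if at most `t` processes may crash. -/
def Implementable {n m : ℕ} (S : Fin m → Set (Fin n)) (t : ℕ) (w : Fin n) {V : Type u} (v₀ : V) :
    Prop :=
  ∃ A : Algorithm S V, A.Implements t w v₀

end MM

namespace MM

/-! ### Thresholds -/

/-! For distinct processes, being equal to or adjacent in `G²` amounts to sharing some `N⁺(p_i)`, so
the two thresholds coincide. Everything else is proved for an arbitrary bag `S` of sets that covers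
the processes, with threshold `tL S`.

Possibility: the protocol is that of Attiya, Bar-Noy and Dolev, with quorums of `n - t` processes
that need not intersect. Every process repeats the same pass: copy its timestamped pair to all
registers that it owns, read all registers that it may read, send its pair to everybody, and then
try to receive one message. It acknowledges a round only after the register accesses of a pass that
began once it had heard of that round. Hence, when a quorum has acknowledged, the registers of its
members carry the timestamp of the round (`Stored`), and the caller knows everything that its
members could read when the round began (`Gathered`). If `P` stored before `P'` gathered, then `t ≤
tL S` gives `u ∈ P` and `v ∈ P'` in a common `S i`, and `v` has read `R_i[u]`; this is
`Run.le_of_stored_of_gathered`, the substitute for quorum intersection. Every operation gathers in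
its first round and stores in its second one, and atomicity follows by comparing timestamps.
Operations terminate because at least `n - t` processes are correct and answer.

Impossibility: above the threshold there are nonempty disjoint sets `P`, `P'` of enough processes
such that no `S i` meets both. Let `P` alone execute a write, and then let `P'` alone execute a read
while all messages from `P` are delayed. No register joins the two sets, so the read behaves as if
nothing had been written and returns the initial value (`not_implements_of_separated`). -/

theorem squareAdj_iff_closedNbhd {n : ℕ} (G : SimpleGraph (Fin n)) {u v : Fin n} (h : u ≠ v) :
    SquareAdj G u v ↔ ∃ i, u ∈ closedNbhd G i ∧ v ∈ closedNbhd G i := by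
  simp only [SquareAdj, closedNbhd, Set.mem_insert_iff, SimpleGraph.mem_neighborSet]
  constructor
  · rintro (h1 | ⟨k, h1, h2⟩)
    · exact ⟨u, Or.inl rfl, Or.inr h1⟩
    · exact ⟨k, Or.inr h1.symm, Or.inr h2⟩
  · rintro ⟨i, rfl | h1, rfl | h2⟩
    · exact absurd rfl h
    · exact Or.inl h2
    · exact Or.inl h1.symm
    · exact Or.inr ⟨i, h1.symm, h2⟩

/-- The diagonal of the relation is irrelevant, because `u = v` with `u ∈ P` and `v ∈ P'` already
makes `P ∩ P'` nonempty. This matters at isolated vertices, where `G²` has no loop although `N⁺`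
contains the vertex. -/
theorem maxResilience_congr {n : ℕ} {rel rel' : Fin n → Fin n → Prop}
    (h : ∀ u v, u ≠ v → (rel u v ↔ rel' u v)) : maxResilience rel = maxResilience rel' := by
  have key : ∀ P P' : Finset (Fin n), ((P ∩ P').Nonempty ∨ ∃ u ∈ P, ∃ v ∈ P', rel u v) ↔
      ((P ∩ P').Nonempty ∨ ∃ u ∈ P, ∃ v ∈ P', rel' u v) := by
    intro P P'
    by_cases hP : (P ∩ P').Nonempty
    · simp [hP]
    · simp only [hP, false_or]
      have hne : ∀ u ∈ P, ∀ v ∈ P', u ≠ v := by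
        rintro u hu v hv rfl
        exact hP ⟨u, Finset.mem_inter.2 ⟨hu, hv⟩⟩
      exact exists_congr fun u => and_congr_right fun hu => exists_congr fun v =>
        and_congr_right fun hv => h u v (hne u hu v hv)
  simp only [maxResilience, key]

theorem tG_eq_tL {n : ℕ} (G : SimpleGraph (Fin n)) : tG G = tL (closedNbhd G) :=
  maxResilience_congr fun _ _ h => squareAdj_iff_closedNbhd G h

/-- Two sets of at least `n - t` processes, with `t ≤ t_L`, meet a common set of the bag. -/
theorem exists_common_of_le_tL {n m : ℕ} (hn : 0 < n) {S : Fin m → Set (Fin n)}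
    (hS : ∀ p, ∃ i, p ∈ S i) {t : ℕ} (ht : t ≤ tL S) {P P' : Finset (Fin n)}
    (hP : n - t ≤ P.card) (hP' : n - t ≤ P'.card) :
    ∃ i, ∃ u ∈ P, ∃ v ∈ P', u ∈ S i ∧ v ∈ S i := by
  obtain ⟨⟨-, h⟩, -⟩ := isGreatest_maxResilience hn fun u v => ∃ i, u ∈ S i ∧ v ∈ S i
  -- The threshold speaks of sets of exactly `n - tL S` processes, so both sets are shrunk to that
  -- size.
  have ht' : n - tL S ≤ n - t := by omega
  obtain ⟨Q, hQ, hQc⟩ := Finset.exists_subset_card_eq (ht'.trans hP)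
  obtain ⟨Q', hQ', hQc'⟩ := Finset.exists_subset_card_eq (ht'.trans hP')
  rcases h Q Q' hQc hQc' with ⟨u, hu⟩ | ⟨u, hu, v, hv, i, hi⟩
  · rw [Finset.mem_inter] at hu
    obtain ⟨i, hi⟩ := hS u
    exact ⟨i, u, hQ hu.1, u, hQ' hu.2, hi, hi⟩
  · exact ⟨i, u, hQ hu, v, hQ' hv, hi⟩

theorem exists_separated_of_tL_lt {n m : ℕ} {S : Fin m → Set (Fin n)} {t : ℕ} (ht : tL S < t)
    (htn : t ≤ n) :
    ∃ P P' : Finset (Fin n), P.card = n - t ∧ P'.card = n - t ∧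
      ∀ i, ∀ u ∈ P, ∀ v ∈ P', u ∈ S i → v ∉ S i := by
  by_contra! hcon
  refine absurd (le_csSup (s := {t : ℕ | t ≤ n ∧ ∀ P P' : Finset (Fin n), P.card = n - t →
    P'.card = n - t → (P ∩ P').Nonempty ∨ ∃ u ∈ P, ∃ v ∈ P', ∃ i, u ∈ S i ∧ v ∈ S i})
    ⟨n, fun t ht => ht.1⟩ ⟨htn, fun P P' hP hP' => Or.inr ?_⟩) (not_le.2 ht)
  obtain ⟨i, u, hu, v, hv, h1, h2⟩ := hcon P P' hP hP'
  exact ⟨u, hu, v, hv, i, h1, h2⟩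

theorem Algorithm.Implements.mono {n m : ℕ} {S : Fin m → Set (Fin n)} {V : Type u}
    {A : Algorithm S V} {t t' : ℕ} {w : Fin n} {v₀ : V} (h : A.Implements t w v₀) (ht : t' ≤ t) :
    A.Implements t' w v₀ := fun r h1 h2 h3 => h r h1 h2 (h3.trans ht)

/-! ### Infinite executions from an arbitrary configuration -/

section Executions

variable {n m : ℕ} {S : Fin m → Set (Fin n)} {V : Type u} {A : Algorithm S V} {w : Fin n}

/-- `cfg` and `ev` form an infinite execution that starts in configuration `C`. -/
def IsExec (A : Algorithm S V) (w : Fin n) (C : Config A) (cfg : ℕ → Config A)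
    (ev : ℕ → Event n V A.Msg) : Prop :=
  cfg 0 = C ∧ ∀ k, Step A w (cfg k) (ev k) (cfg (k + 1))

/-- Follow `f` before time `N`, and then follow `g`. -/
def splice {α : Type*} (N : ℕ) (f g : ℕ → α) (k : ℕ) : α := if k < N then f k else g (k - N)

theorem splice_of_lt {α : Type*} {N k : ℕ} (f g : ℕ → α) (h : k < N) : splice N f g k = f k :=
  if_pos h

theorem splice_add {α : Type*} (N k : ℕ) (f g : ℕ → α) : splice N f g (N + k) = g k := by
  simp [splice]

theorem IsExec.splice {C : Config A} {cfg cfg' : ℕ → Config A} {ev ev' : ℕ → Event n V A.Msg}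
    (h : IsExec A w C cfg ev) (N : ℕ) (h' : IsExec A w (cfg N) cfg' ev') :
    IsExec A w C (splice N cfg cfg') (splice N ev ev') := by
  have hle : ∀ k ≤ N, MM.splice N cfg cfg' k = cfg k := by
    intro k hk
    rcases hk.lt_or_eq with hk | rfl
    · exact splice_of_lt _ _ hk
    · simpa [h'.1] using splice_add k 0 cfg cfg'
  refine ⟨(hle 0 (Nat.zero_le _)).trans h.1, fun k => ?_⟩
  rcases lt_or_ge k N with hk | hk
  · rw [hle k hk.le, hle (k + 1) hk, splice_of_lt _ _ hk]
    exact h.2 k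
  · obtain ⟨j, rfl⟩ := Nat.exists_eq_add_of_le hk
    rw [add_assoc, splice_add, splice_add, splice_add]
    exact h'.2 j

/-- Only a reception removes a message from the network. This carries reliability of links from the
tail of a spliced execution over to the whole execution. -/
theorem mem_net_or_received {cfg : ℕ → Config A} {ev : ℕ → Event n V A.Msg}
    (h : ∀ k, Step A w (cfg k) (ev k) (cfg (k + 1))) {k : ℕ} {p q : Fin n} {a : A.Msg}
    (hk : (p, q, a) ∈ (cfg k).net) (d : ℕ) :
    (p, q, a) ∈ (cfg (k + d)).net ∨ ∃ j ≥ k, ev j = .recv q (some (p, a)) := by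
  induction d with
  | zero => exact Or.inl hk
  | succ d ih =>
    rcases ih with ih | ih
    · have hs := h (k + d)
      rw [← add_assoc]
      generalize he : ev (k + d) = e at hs
      generalize cfg (k + d) = C at hs ih
      generalize cfg (k + d + 1) = C' at hs
      cases hs with
      | recvSome p' q' a' net' f hact hnet =>
        rw [hnet, Multiset.mem_cons] at ih
        rcases ih with ih | ih
        · obtain ⟨rfl, rfl, rfl⟩ := by simpa using ih
          exact Or.inr ⟨k + d, by omega, he⟩
        · exact Or.inl ih
      | send => exact Or.inl (Multiset.mem_cons_of_mem ih)
      | _ => exact Or.inl ih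
    · exact Or.inr ih

/-- The messages to `q` in a list of messages. -/
def msgsTo {α : Type*} (q : Fin n) (l : List (Fin n × Fin n × α)) : List (Fin n × Fin n × α) :=
  l.filter fun x => x.2.1 = q

/-- One step of the scheduler: process `p` takes a step; if that step tries to receive a message,
then it receives the message for `p` that was sent first. -/
theorem exists_step_of (C : Config A) (l : List (Fin n × Fin n × A.Msg)) (hl : C.net = ↑l)
    (p : Fin n) :
    ∃ (e : Event n V A.Msg) (C' : Config A) (l' : List (Fin n × Fin n × A.Msg)),
      C'.net = ↑l' ∧ Step A w C e C' ∧ (∀ q, e.IsStepOf q ↔ q = p) ∧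
      (∀ q, (∀ o, e ≠ .recv q o) → msgsTo q l <+: msgsTo q l') ∧
      ∀ q o x L, e = .recv q o → msgsTo q l = x :: L →
        o = some (x.1, x.2.2) ∧ x.2.1 = q ∧ msgsTo q l' = L := by
  cases hact : A.act p (C.state p) with
  | send q a s =>
    refine ⟨_, _, l ++ [(p, q, a)], ?_, Step.send C p q a s hact, ?_, ?_, ?_⟩
    · simp only [hl]
      rw [Multiset.cons_coe]
      exact Multiset.coe_eq_coe.2 (List.perm_append_singleton _ _).symm
    · simp [Event.IsStepOf, eq_comm]
    · intro q' _
      simp [msgsTo]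
    · simp
  | recv k =>
    by_cases hm : ∃ x ∈ l, x.2.1 = p
    · obtain ⟨x, hx, hxp⟩ := hm
      have hx' : (fun y : Fin n × Fin n × A.Msg => decide (y.2.1 = p)) x = true := by simpa using hxp
      -- `eraseP` singles out the oldest message for `p`: none of the messages in `l1` is for `p`.
      obtain ⟨⟨b, p', a⟩, l1, l2, h1, h2, h3, h4⟩ := List.exists_of_eraseP
        (p := fun y : Fin n × Fin n × A.Msg => decide (y.2.1 = p)) hx hx'
      obtain rfl : p' = p := by simpa using h2
      have h1' : l1.filter (fun y => decide (y.2.1 = p')) = [] := by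
        rw [List.filter_eq_nil_iff]
        exact h1
      refine ⟨_, _, l1 ++ l2, ?_, Step.recvSome C p' b a ↑(l1 ++ l2) k hact ?_, ?_, ?_, ?_⟩
      · rfl
      · rw [hl, h3, Multiset.cons_coe, Multiset.coe_eq_coe]
        exact List.perm_middle
      · simp [Event.IsStepOf, eq_comm]
      · intro q hq
        have hq' : p' ≠ q := by
          rintro rfl
          exact hq _ rfl
        simp [msgsTo, h3, hq']
      · intro q o y L he hL
        obtain ⟨rfl, rfl⟩ := by simpa using he
        simp only [msgsTo, h3, List.filter_append, h1', List.nil_append] at hL ⊢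
        simp only [decide_true, List.filter_cons_of_pos, List.cons.injEq] at hL
        obtain ⟨rfl, rfl⟩ := hL
        simp
    · push Not at hm
      refine ⟨_, _, l, ?_, Step.recvNone C p k hact, ?_, ?_, ?_⟩
      · exact hl
      · simp [Event.IsStepOf, eq_comm]
      · intro q _
        exact List.prefix_rfl
      · intro q o y L he hL
        obtain ⟨rfl, rfl⟩ := by simpa using he
        have hy : y ∈ msgsTo p l := by simp [hL]
        simp only [msgsTo, List.mem_filter, decide_eq_true_eq] at hy
        exact absurd hy.2 (hm y hy.1)
  | read R hp k =>
    refine ⟨_, _, l, ?_, Step.read C p R hp k hact, ?_, fun q _ => List.prefix_rfl, ?_⟩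
    · exact hl
    · simp [Event.IsStepOf, eq_comm]
    · simp
  | write i hp x s =>
    refine ⟨_, _, l, ?_, Step.write C p i hp x s hact, ?_, fun q _ => List.prefix_rfl, ?_⟩
    · exact hl
    · simp [Event.IsStepOf, eq_comm]
    · simp
  | ret v s =>
    refine ⟨_, _, l, ?_, Step.ret C p v s hact, ?_, fun q _ => List.prefix_rfl, ?_⟩
    · exact hl
    · simp [Event.IsStepOf, eq_comm]
    · simp

/-- If messages are received in the order in which they were sent, then links are reliable. -/
theorem exists_received_of_fifo {α : Type u} {ev : ℕ → Event n V α}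
    {l : ℕ → List (Fin n × Fin n × α)} {q : Fin n}
    (h1 : ∀ k, (∀ o, ev k ≠ .recv q o) → msgsTo q (l k) <+: msgsTo q (l (k + 1)))
    (h2 : ∀ k o x L, ev k = .recv q o → msgsTo q (l k) = x :: L →
        o = some (x.1, x.2.2) ∧ x.2.1 = q ∧ msgsTo q (l (k + 1)) = L)
    (hq : ∀ k, ∃ k' ≥ k, ∃ o, ev k' = .recv q o) (L₁ : List (Fin n × Fin n × α)) :
    ∀ (k : ℕ) (L₂ : List (Fin n × Fin n × α)) (p : Fin n) (a : α),
      msgsTo q (l k) = L₁ ++ (p, q, a) :: L₂ →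
      ∃ k' ≥ k, ev k' = .recv q (some (p, a)) := by
  -- `L₁` lists the messages that `q` must receive earlier, and each reception removes its head. The
  -- inner inductions are on the delay `d` before a known reception by `q`.
  induction L₁ with
  | nil =>
    intro k L₂ p a hk
    obtain ⟨k', hk', o, ho⟩ := hq k
    obtain ⟨d, rfl⟩ := Nat.exists_eq_add_of_le hk'
    clear hk'
    induction d generalizing k L₂ with
    | zero =>
      obtain ⟨rfl, -, -⟩ := h2 _ _ _ _ ho hk
      exact ⟨k, le_rfl, ho⟩
    | succ d ih =>
      by_cases hr : ∃ o', ev k = .recv q o'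
      · obtain ⟨o', ho'⟩ := hr
        obtain ⟨rfl, -, -⟩ := h2 _ _ _ _ ho' hk
        exact ⟨k, le_rfl, ho'⟩
      · push Not at hr
        obtain ⟨L, hL⟩ := h1 k hr
        obtain ⟨k', hk', h⟩ := ih (k + 1) (L₂ ++ L) (by rw [← hL, hk]; simp)
          (by rw [← ho]; congr 1; omega)
        exact ⟨k', by omega, h⟩
  | cons x L₁ ihL =>
    intro k L₂ p a hk
    obtain ⟨k', hk', o, ho⟩ := hq k
    obtain ⟨d, rfl⟩ := Nat.exists_eq_add_of_le hk'
    clear hk'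
    induction d generalizing k L₂ with
    | zero =>
      obtain ⟨-, -, hL⟩ := h2 _ _ _ _ ho hk
      obtain ⟨k', hk', h⟩ := ihL _ _ _ _ hL
      exact ⟨k', by omega, h⟩
    | succ d ih =>
      by_cases hr : ∃ o', ev k = .recv q o'
      · obtain ⟨o', ho'⟩ := hr
        obtain ⟨-, -, hL⟩ := h2 _ _ _ _ ho' hk
        obtain ⟨k', hk', h⟩ := ihL _ _ _ _ hL
        exact ⟨k', by omega, h⟩
      · push Not at hr
        obtain ⟨L, hL⟩ := h1 k hr
        obtain ⟨k', hk', h⟩ := ih (k + 1) (L₂ ++ L) (by rw [← hL, hk]; simp)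
          (by rw [← ho]; congr 1; omega)
        exact ⟨k', by omega, h⟩

/-- From every configuration there is an execution in which no operation is called, the processes
in `X` take infinitely many steps, the other ones take none, and links are reliable. -/
theorem exists_fair_exec (C : Config A) (X : Set (Fin n)) :
    ∃ cfg ev, IsExec A w C cfg ev ∧ (∀ k p op, ev k ≠ .call p op) ∧
      (∀ k p, (ev k).IsStepOf p → p ∈ X) ∧
      (∀ p ∈ X, ∀ k, ∃ k' ≥ k, (ev k').IsStepOf p) ∧
      ∀ q, (∀ k, ∃ k' ≥ k, ∃ o, ev k' = .recv q o) →
        ∀ k p a, (p, q, a) ∈ (cfg k).net → ∃ k' ≥ k, ev k' = .recv q (some (p, a)) := by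
  classical
  have hn : 0 < n := Nat.lt_of_le_of_lt (Nat.zero_le _) w.2
  -- Configurations are enriched with a queue that lists the multiset of messages in transit. At
  -- time `k` the turn belongs to process `k % n`, which is skipped if it is not in `X`.
  let Q := {x : Config A × List (Fin n × Fin n × A.Msg) // x.1.net = ↑x.2}
  have hstep : ∀ (k : ℕ) (x : Q), ∃ y : Event n V A.Msg × Q,
      Step A w x.1.1 y.1 y.2.1.1 ∧ (∀ p op, y.1 ≠ .call p op) ∧
      (∀ q, y.1.IsStepOf q ↔ q = ⟨k % n, Nat.mod_lt _ hn⟩ ∧ q ∈ X) ∧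
      (∀ q, (∀ o, y.1 ≠ .recv q o) → msgsTo q x.1.2 <+: msgsTo q y.2.1.2) ∧
      ∀ q o x' L, y.1 = .recv q o → msgsTo q x.1.2 = x' :: L →
        o = some (x'.1, x'.2.2) ∧ x'.2.1 = q ∧ msgsTo q y.2.1.2 = L := by
    rintro k ⟨⟨C, l⟩, hl⟩
    by_cases hX : (⟨k % n, Nat.mod_lt _ hn⟩ : Fin n) ∈ X
    · obtain ⟨e, C', l', h0, h1, h2, h3, h4⟩ :=
        exists_step_of (w := w) C l hl ⟨k % n, Nat.mod_lt _ hn⟩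
      refine ⟨⟨e, ⟨(C', l'), h0⟩⟩, h1, ?_, ?_, h3, h4⟩
      · rintro p op rfl
        exact ((h2 _).2 rfl).elim
      · intro q
        rw [h2]
        constructor
        · rintro rfl
          exact ⟨rfl, hX⟩
        · exact fun h => h.1
    · refine ⟨⟨.idle, ⟨(C, l), hl⟩⟩, Step.idle C, by simp, ?_, fun q _ => List.prefix_rfl, by simp⟩
      intro q
      simp only [Event.IsStepOf, false_iff]
      rintro ⟨rfl, h⟩
      exact hX h
  choose f hf using hstep
  obtain ⟨l₀, hl₀⟩ := Quot.exists_rep C.net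
  let x : ℕ → Q := fun k => Nat.rec ⟨(C, l₀), hl₀.symm⟩ (fun k x => (f k x).2) k
  refine ⟨fun k => (x k).1.1, fun k => (f k (x k)).1, ⟨rfl, fun k => (hf k (x k)).1⟩,
    fun k => (hf k (x k)).2.1, fun k p h => (((hf k (x k)).2.2.1 p).1 h).2, ?_, ?_⟩
  · intro p hp k
    -- A time that is at least `k` and at which it is the turn of `p`.
    refine ⟨p + n * k, ?_, ((hf _ (x _)).2.2.1 p).2 ⟨?_, hp⟩⟩
    · have := Nat.le_mul_of_pos_left k hn
      omega
    · ext
      simp [Nat.mod_eq_of_lt p.2]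
  · intro q hq k p a ha
    have ha' : (p, q, a) ∈ msgsTo q (x k).1.2 := by
      have h := (x k).2
      rw [h] at ha
      simpa [msgsTo] using ha
    obtain ⟨L₁, L₂, hL⟩ := List.append_of_mem ha'
    exact exists_received_of_fifo (l := fun k => (x k).1.2)
      (fun k => (hf k (x k)).2.2.2.1 q) (fun k => (hf k (x k)).2.2.2.2 q) hq L₁ k L₂ p a hL

/-- A run in which `p` calls `op` at time `0`, no other operation is called, exactly the processes
in `X` do not crash, and the other ones take no step. -/
theorem exists_solo_run (A : Algorithm S V) (w p : Fin n) (op : Op V)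
    (hop : ∀ v, op = .write v → p = w) (X : Set (Fin n)) :
    ∃ r : Run A w, r.ReliableLinks ∧ r.crashed = Xᶜ ∧ r.ev 0 = .call p op ∧
      (∀ k p' op', r.ev k = .call p' op' → k = 0) ∧ ∀ k p', (r.ev k).IsStepOf p' → p' ∈ X := by
  have hcall := Step.call (A := A) (w := w) (Config.initial A) p op hop rfl
  obtain ⟨cfg, ev, ⟨h0, h1⟩, h2, h3, h4, h5⟩ := exists_fair_exec (A := A) (w := w)
    { Config.initial A with
      state := Function.update (Config.initial A).state p (A.call p op ((Config.initial A).state p))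
      busy := Function.update (Config.initial A).busy p true } X
  let r : Run A w :=
    { cfg := fun k => Nat.casesOn k (Config.initial A) cfg
      ev := fun k => Nat.casesOn k (.call p op) ev
      cfg_zero := rfl
      step := by
        rintro (_ | k)
        · change Step A w _ _ (cfg 0)
          rw [h0]
          exact hcall
        · exact h1 k }
  have hcor : ∀ q, r.Correct q ↔ q ∈ X := by
    intro q
    constructor
    · intro h
      obtain ⟨k | k, hk, h⟩ := h 1
      · omega
      · exact h3 k q h
    · intro h k
      obtain ⟨k', hk', h⟩ := h4 q h k
      exact ⟨k' + 1, by omega, h⟩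
  refine ⟨r, ?_, ?_, rfl, ?_, ?_⟩
  · rintro q hq (_ | k) p' a ha
    · exact absurd ha (Multiset.notMem_zero _)
    · obtain ⟨k', hk', h⟩ := h5 q (fun k => by
        obtain ⟨k' | k', hk', h⟩ := hq (k + 1)
        · omega
        · exact ⟨k', by omega, h⟩) k p' a ha
      exact ⟨k' + 1, by omega, h⟩
  · ext q
    simp [Run.crashed, hcor]
  · rintro (_ | k) p' op' h
    · rfl
    · exact absurd h (h2 k p' op')
  · rintro (_ | k) p' h
    · exact h.elim
    · exact h3 k p' h

end Executions
/-! ### Impossibility -/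

section Impossibility

variable {n m : ℕ} {S : Fin m → Set (Fin n)} {V : Type u} {A : Algorithm S V} {w : Fin n}

/-- The processes that do something at an event all belong to `X`. -/
def Event.IsAt {Msg : Type u} (X : Set (Fin n)) (e : Event n V Msg) : Prop :=
  (∀ p, e.IsStepOf p → p ∈ X) ∧ ∀ p op, e = .call p op → p ∈ X

/-- A step of processes in `X` does not affect the other ones, nor their registers. -/
theorem Step.eq_of_notMem {C C' : Config A} {e : Event n V A.Msg} (h : Step A w C e C')
    {X : Set (Fin n)} (he : e.IsAt X) :
    (∀ p ∉ X, C'.state p = C.state p ∧ C'.busy p = C.busy p) ∧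
      ∀ R : Reg S, R.1.2 ∉ X → C'.regs R = C.regs R := by
  have hne : ∀ {p q : Fin n}, q ∈ X → p ∉ X → p ≠ q := by
    rintro p q hq hp rfl
    exact hp hq
  cases h with
  | idle => simp
  | call p op hw hb =>
    have hp := he.2 p op rfl
    exact ⟨fun q hq => by simp [hne hp hq], fun R _ => rfl⟩
  | send p q a s hact =>
    have hp := he.1 p rfl
    exact ⟨fun q hq => by simp [hne hp hq], fun R _ => rfl⟩
  | recvNone p k hact =>
    have hp := he.1 p rfl
    exact ⟨fun q hq => by simp [hne hp hq], fun R _ => rfl⟩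
  | recvSome p q a net' k hact hnet =>
    have hp := he.1 p rfl
    exact ⟨fun q hq => by simp [hne hp hq], fun R _ => rfl⟩
  | read p R hR k hact =>
    have hp := he.1 p rfl
    exact ⟨fun q hq => by simp [hne hp hq], fun R _ => rfl⟩
  | write p i hi x s hact =>
    have hp := he.1 p rfl
    refine ⟨fun q hq => by simp [hne hp hq], fun R hR => Function.update_of_ne ?_ _ _⟩
    rintro rfl
    exact hR hp
  | ret p v s hact =>
    have hp := he.1 p rfl
    exact ⟨fun q hq => by simp [hne hp hq], fun R _ => rfl⟩

/-- The processes in `X` do not notice the difference between `D` and `E`, but `E` may have more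
messages in transit. -/
structure Indist (X : Set (Fin n)) (D E : Config A) : Prop where
  state : ∀ p ∈ X, E.state p = D.state p
  busy : ∀ p ∈ X, E.busy p = D.busy p
  net : D.net ≤ E.net
  regs : ∀ R : Reg S, (∃ p ∈ X, p ∈ S R.1.1) → E.regs R = D.regs R

theorem update_eq_update_of_eq {α β : Type*} [DecidableEq α] {f g : α → β} {X : Set α}
    (h : ∀ a ∈ X, f a = g a) (b : α) (y : β) :
    ∀ a ∈ X, Function.update f b y a = Function.update g b y a := by
  intro a ha
  rcases eq_or_ne a b with rfl | hab
  · simp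
  · simp [hab, h a ha]

/-- A step depends only on the state of its process, on a message that is also in transit in `E`, or
on a register that a process in `X` may read. Surplus messages in `E` do no harm: they need not be
received, and an attempt to receive may always fail. -/
theorem Indist.exists_step {X : Set (Fin n)} {D E D' : Config A} {e : Event n V A.Msg}
    (h : Indist X D E) (hs : Step A w D e D') (he : e.IsAt X) :
    ∃ E', Step A w E e E' ∧ Indist X D' E' := by
  cases hs with
  | idle => exact ⟨E, Step.idle E, h⟩
  | call p op hw hb =>
    have hp := he.2 p op rfl
    refine ⟨_, Step.call E p op hw (by rw [h.busy p hp, hb]), ?_, ?_, h.net, h.regs⟩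
    · rw [h.state p hp]
      exact update_eq_update_of_eq h.state _ _
    · exact update_eq_update_of_eq h.busy _ _
  | send p q a s hact =>
    have hp := he.1 p rfl
    exact ⟨_, Step.send E p q a s (by rw [h.state p hp, hact]),
      update_eq_update_of_eq h.state _ _, h.busy, Multiset.cons_le_cons _ h.net, h.regs⟩
  | recvNone p k hact =>
    have hp := he.1 p rfl
    exact ⟨_, Step.recvNone E p k (by rw [h.state p hp, hact]),
      update_eq_update_of_eq h.state _ _, h.busy, h.net, h.regs⟩
  | recvSome p q a net' k hact hnet =>
    have hp := he.1 p rfl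
    obtain ⟨M, hM⟩ := Multiset.le_iff_exists_add.1 h.net
    exact ⟨_, Step.recvSome E p q a (net' + M) k (by rw [h.state p hp, hact])
      (by rw [hM, hnet, Multiset.cons_add]),
      update_eq_update_of_eq h.state _ _, h.busy, Multiset.le_add_right _ _, h.regs⟩
  | read p R hR k hact =>
    have hp := he.1 p rfl
    refine ⟨_, Step.read E p R hR k (by rw [h.state p hp, hact]), ?_, h.busy, h.net, h.regs⟩
    rw [h.regs R ⟨p, hp, hR⟩]
    exact update_eq_update_of_eq h.state _ _
  | write p i hi x s hact =>
    have hp := he.1 p rfl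
    exact ⟨_, Step.write E p i hi x s (by rw [h.state p hp, hact]),
      update_eq_update_of_eq h.state _ _, h.busy, h.net,
      update_eq_update_of_eq (X := {R : Reg S | ∃ p ∈ X, p ∈ S R.1.1}) h.regs _ _⟩
  | ret p v s hact =>
    have hp := he.1 p rfl
    exact ⟨_, Step.ret E p v s (by rw [h.state p hp, hact]),
      update_eq_update_of_eq h.state _ _, update_eq_update_of_eq h.busy _ _, h.net, h.regs⟩

/-- The events of a run in which only processes in `X` take steps can also occur from any
configuration that these processes do not distinguish from the initial one. -/
theorem Indist.exists_exec {X : Set (Fin n)} {E : Config A} (h : Indist X (Config.initial A) E)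
    (r : Run A w) (hr : ∀ k, (r.ev k).IsAt X) : ∃ cfg, IsExec A w E cfg r.ev := by
  have hstep : ∀ k (E : {E // Indist X (r.cfg k) E}), ∃ E' : {E' // Indist X (r.cfg (k + 1)) E'},
      Step A w E.1 (r.ev k) E'.1 := by
    rintro k ⟨E, hE⟩
    obtain ⟨E', h1, h2⟩ := hE.exists_step (r.step k) (hr k)
    exact ⟨⟨E', h2⟩, h1⟩
  choose f hf using hstep
  let x : ∀ k, {E // Indist X (r.cfg k) E} :=
    fun k => Nat.rec ⟨E, by rw [r.cfg_zero]; exact h⟩ (fun k x => f k x) k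
  exact ⟨fun k => (x k).1, rfl, fun k => hf k (x k)⟩

theorem Run.not_call_of_solo {r : Run A w} {p : Fin n} {op : Op V} (h0 : r.ev 0 = .call p op)
    (h : ∀ k p' op', r.ev k = .call p' op' → k = 0) {k : ℕ} {p' : Fin n} {op' : Op V}
    (hk : r.ev k = .call p' op') : k = 0 ∧ p' = p ∧ op' = op := by
  obtain rfl := h k p' op' hk
  rw [h0] at hk
  cases hk
  exact ⟨rfl, rfl, rfl⟩

/-- Each half runs alone in a legitimate run, since the complements of `P` and `P'` have at most `t`
processes, so both operations terminate. The finite prefixes up to the two returns are then glued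
into one run in which the read follows the write and misses it. -/
theorem not_implements_of_separated {t : ℕ} {P P' : Finset (Fin n)} (hP : n ≤ P.card + t)
    (hP' : n ≤ P'.card + t) (hsep : ∀ i, ∀ u ∈ P, ∀ v ∈ P', u ∈ S i → v ∉ S i)
    (hdisj : Disjoint P P') (hw : w ∈ P) {p : Fin n} (hp : p ∈ P') {v v₀ : V} (hv : v ≠ v₀) :
    ¬ A.Implements t w v₀ := by
  intro hA
  have hcard : ∀ P : Finset (Fin n), n ≤ P.card + t → ((P : Set (Fin n))ᶜ).ncard ≤ t := by
    intro P hP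
    rw [Set.ncard_compl, Set.ncard_coe_finset, Nat.card_eq_fintype_card, Fintype.card_fin]
    omega
  -- the write, executed by the processes in `P`
  obtain ⟨r₁, hl₁, hc₁, h0₁, hcall₁, hst₁⟩ :=
    exists_solo_run A w w (.write v) (fun _ _ => rfl) (P : Set (Fin n))
  have hd₁ : r₁.DistinctWrites v₀ := by
    intro s q v' hs
    obtain ⟨rfl, -, h⟩ := Run.not_call_of_solo h0₁ hcall₁ hs
    cases h
    exact ⟨hv, fun s' q' h => hcall₁ _ _ _ h⟩
  have hat₁ : ∀ k, (r₁.ev k).IsAt (P : Set (Fin n)) := by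
    refine fun k => ⟨hst₁ k, fun q op h => ?_⟩
    obtain ⟨-, rfl, -⟩ := Run.not_call_of_solo h0₁ hcall₁ h
    exact hw
  obtain ⟨-, -, hlive₁⟩ := hA r₁ hl₁ hd₁ (by rw [hc₁]; exact hcard P hP)
  have hcor₁ : r₁.Correct w := by
    by_contra hcon
    have : w ∈ r₁.crashed := hcon
    rw [hc₁] at this
    exact this hw
  obtain ⟨f, x, q₁, op₁, hq₁, hf, hretf, hminf⟩ := hlive₁ 0 w _ h0₁ hcor₁
  obtain ⟨-, rfl, -⟩ := Run.not_call_of_solo h0₁ hcall₁ hq₁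
  -- the read, executed by the processes in `P'`
  obtain ⟨r₂, hl₂, hc₂, h0₂, hcall₂, hst₂⟩ :=
    exists_solo_run A q₁ p .read (fun _ h => by cases h) (P' : Set (Fin n))
  have hd₂ : r₂.DistinctWrites v₀ := by
    intro s q v' hs
    obtain ⟨-, -, h⟩ := Run.not_call_of_solo h0₂ hcall₂ hs
    cases h
  have hat₂ : ∀ k, (r₂.ev k).IsAt (P' : Set (Fin n)) := by
    refine fun k => ⟨hst₂ k, fun q op h => ?_⟩
    obtain ⟨-, rfl, -⟩ := Run.not_call_of_solo h0₂ hcall₂ h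
    exact hp
  obtain ⟨hprop₂, -, hlive₂⟩ := hA r₂ hl₂ hd₂ (by rw [hc₂]; exact hcard P' hP')
  have hcor₂ : r₂.Correct p := by
    by_contra hcon
    have : p ∈ r₂.crashed := hcon
    rw [hc₂] at this
    exact this hp
  obtain ⟨g, y, hret₂⟩ := hlive₂ 0 p _ h0₂ hcor₂
  have hy : y = v₀ := by
    rcases hprop₂ 0 g y ⟨p, h0₂⟩ hret₂ with ⟨s', ⟨q, hq⟩, -⟩ | ⟨-, h⟩
    · obtain ⟨-, -, h⟩ := Run.not_call_of_solo h0₂ hcall₂ hq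
      cases h
    · exact h
  subst hy
  obtain ⟨q₂, op₂, hq₂, hg, hretg, hming⟩ := hret₂
  obtain ⟨-, rfl, -⟩ := Run.not_call_of_solo h0₂ hcall₂ hq₂
  -- the write followed by the read
  have hind : Indist (P' : Set (Fin n)) (Config.initial A) (r₁.cfg (f + 1)) := by
    have hsame : ∀ k, (∀ q ∉ (P : Set (Fin n)), (r₁.cfg k).state q = A.init q ∧
        (r₁.cfg k).busy q = false) ∧
        ∀ R : Reg S, R.1.2 ∉ (P : Set (Fin n)) → (r₁.cfg k).regs R = A.regInit R := by
      intro k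
      induction k with
      | zero =>
        rw [r₁.cfg_zero]
        exact ⟨fun _ _ => ⟨rfl, rfl⟩, fun _ _ => rfl⟩
      | succ k ih =>
        obtain ⟨h1, h2⟩ := (r₁.step k).eq_of_notMem (hat₁ k)
        exact ⟨fun q hq => ⟨(h1 q hq).1.trans (ih.1 q hq).1, (h1 q hq).2.trans (ih.1 q hq).2⟩,
          fun R hR => (h2 R hR).trans (ih.2 R hR)⟩
    have hnP : ∀ q ∈ (P' : Set (Fin n)), q ∉ (P : Set (Fin n)) :=
      fun q hq hq' => Finset.disjoint_left.1 hdisj hq' hq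
    -- If a register readable by someone in `P'` belonged to a process in `P`, then its index would
    -- give a set of the bag that meets both; `hsep` excludes this. So such a register still has its
    -- initial value.
    refine ⟨fun q hq => ((hsame _).1 q (hnP q hq)).1, fun q hq => ((hsame _).1 q (hnP q hq)).2,
      Multiset.zero_le _, fun R hR => (hsame _).2 R fun hR' => ?_⟩
    obtain ⟨q, hq, hqR⟩ := hR
    exact hsep _ _ hR' _ hq R.2 hqR
  obtain ⟨cfg₂, hex₂⟩ := hind.exists_exec r₂ hat₂
  -- After the read has returned, all processes take steps again and the delayed messages can be
  -- delivered. The glued run therefore has no crash at all.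
  obtain ⟨cfg₃, ev₃, hex₃, hcall₃, -, hfair₃, hl₃⟩ :=
    exists_fair_exec (w := q₁) (cfg₂ (g + 1)) Set.univ
  have hex : IsExec A q₁ (Config.initial A) (splice (f + 1) r₁.cfg (splice (g + 1) cfg₂ cfg₃))
      (splice (f + 1) r₁.ev (splice (g + 1) r₂.ev ev₃)) :=
    IsExec.splice ⟨r₁.cfg_zero, r₁.step⟩ (f + 1) (hex₂.splice (g + 1) hex₃)
  let r : Run A q₁ := ⟨_, _, hex.1, hex.2⟩
  have hev₁ : ∀ k ≤ f, r.ev k = r₁.ev k := fun k hk => splice_of_lt _ _ (Nat.lt_succ_of_le hk)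
  have hev₂ : ∀ k ≤ g, r.ev (f + 1 + k) = r₂.ev k := fun k hk =>
    (splice_add _ _ _ _).trans (splice_of_lt _ _ (Nat.lt_succ_of_le hk))
  have hev₃ : ∀ k, r.ev (f + 1 + (g + 1 + k)) = ev₃ k := fun k =>
    (splice_add _ _ _ _).trans (splice_add _ _ _ _)
  have hcfg₃ : ∀ k, r.cfg (f + 1 + (g + 1 + k)) = cfg₃ k := fun k =>
    (splice_add _ _ _ _).trans (splice_add _ _ _ _)
  have hcases : ∀ k, k ≤ f ∨ (∃ j ≤ g, k = f + 1 + j) ∨ ∃ j, k = f + 1 + (g + 1 + j) := by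
    intro k
    by_cases h1 : k ≤ f
    · exact Or.inl h1
    · by_cases h2 : k ≤ f + 1 + g
      · exact Or.inr (Or.inl ⟨k - (f + 1), by omega, by omega⟩)
      · exact Or.inr (Or.inr ⟨k - (f + 1 + (g + 1)), by omega⟩)
  have hwrites : ∀ s q v', r.ev s = .call q (.write v') → s = 0 ∧ v' = v := by
    intro s q v' hs
    rcases hcases s with h | ⟨j, hj, rfl⟩ | ⟨j, rfl⟩
    · rw [hev₁ s h] at hs
      obtain ⟨rfl, -, h⟩ := Run.not_call_of_solo h0₁ hcall₁ hs
      cases h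
      exact ⟨rfl, rfl⟩
    · rw [hev₂ j hj] at hs
      obtain ⟨-, -, h⟩ := Run.not_call_of_solo h0₂ hcall₂ hs
      cases h
    · rw [hev₃] at hs
      exact absurd hs (hcall₃ _ _ _)
  have hdist : r.DistinctWrites y := by
    intro s q v' hs
    obtain ⟨rfl, rfl⟩ := hwrites s q v' hs
    exact ⟨hv, fun s' q' h => (hwrites s' q' _ h).1⟩
  have hrel : r.ReliableLinks := by
    intro q hq k p' a ha
    -- Every message is either received or still in transit after a shift that leads into the fair
    -- tail, where links are reliable.
    rcases mem_net_or_received r.step ha (f + 1 + (g + 1)) with h | h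
    · rw [show k + (f + 1 + (g + 1)) = f + 1 + (g + 1 + k) by omega, hcfg₃] at h
      obtain ⟨k', hk', h'⟩ := hl₃ q (fun k => by
        obtain ⟨k', hk', o, ho⟩ := hq (f + 1 + (g + 1 + k))
        refine ⟨k' - (f + 1 + (g + 1)), by omega, o, ?_⟩
        rw [← hev₃, ← ho]
        congr 1
        omega) k p' a h
      exact ⟨_, by omega, (hev₃ k').trans h'⟩
    · exact h
  have hcrash : r.crashed = ∅ := by
    refine Set.eq_empty_of_forall_notMem fun q hq => hq fun k => ?_
    obtain ⟨k', hk', h⟩ := hfair₃ q (Set.mem_univ q) k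
    refine ⟨f + 1 + (g + 1 + k'), by omega, ?_⟩
    rw [hev₃]
    exact h
  obtain ⟨hprop, -, -⟩ := hA r hrel hdist (by simp [hcrash])
  have hread : r.ev (f + 1) = .call q₂ .read := (hev₂ 0 (Nat.zero_le _)).trans h0₂
  have hret : r.Returns (f + 1) (f + 1 + g) y := by
    refine ⟨q₂, _, hread, by omega, (hev₂ g le_rfl).trans hretg, fun j h1 h2 v' => ?_⟩
    obtain ⟨j, rfl⟩ := Nat.exists_eq_add_of_lt h1
    rw [add_assoc, hev₂ _ (by omega)]
    exact hming _ (by omega) (by omega) v'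
  have hwrite : r.Precedes 0 (f + 1) := by
    refine ⟨f, x, ⟨q₁, _, (hev₁ 0 (Nat.zero_le _)).trans h0₁, hf, (hev₁ f le_rfl).trans hretf,
      fun j h1 h2 v' => ?_⟩, Nat.lt_succ_self f⟩
    rw [hev₁ j h2.le]
    exact hminf j h1 h2 v'
  rcases hprop (f + 1) _ y ⟨_, hread⟩ hret with ⟨s', ⟨q, hq⟩, -⟩ | ⟨h, -⟩
  · exact hv (hwrites s' q _ hq).2.symm
  · exact h ⟨0, v, ⟨q₁, (hev₁ 0 (Nat.zero_le _)).trans h0₁⟩, hwrite⟩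

/-- It suffices to refute resilience `tL S + 1`, which any larger resilience implies. The separated
sets then have `n - (tL S + 1)` elements, hence are nonempty by `hlt`, and they are disjoint because
the bag covers every process. -/
theorem exists_not_implementable {n m : ℕ} {S : Fin m → Set (Fin n)} (hS : ∀ p, ∃ i, p ∈ S i)
    (hlt : tL S < n - 1) {t : ℕ} (ht : tL S < t) :
    ∃ w : Fin n, ∀ (V : Type u) [Nontrivial V] (v₀ : V), ¬ Implementable S t w v₀ := by
  obtain ⟨P, P', hP, hP', hsep⟩ :=
    exists_separated_of_tL_lt (S := S) (Nat.lt_succ_self _) (by omega)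
  obtain ⟨w, hw⟩ : P.Nonempty := Finset.card_pos.1 (by omega)
  obtain ⟨p, hp⟩ : P'.Nonempty := Finset.card_pos.1 (by omega)
  refine ⟨w, ?_⟩
  rintro V _ v₀ ⟨A, hA⟩
  obtain ⟨v, hv⟩ := exists_ne v₀
  refine not_implements_of_separated (by omega) (by omega) hsep ?_ hw hp hv
    (hA.mono (Nat.succ_le_of_lt ht))
  refine Finset.disjoint_left.2 fun q hq hq' => ?_
  obtain ⟨i, hi⟩ := hS q
  exact hsep i q hq q hq' hi hi

end Impossibility
/-! ### The algorithm -/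

section Protocol

variable {n m : ℕ} {S : Fin m → Set (Fin n)} {V : Type u}

/-- The pair with the larger timestamp. -/
def join (x y : ℕ × V) : ℕ × V := if x.1 < y.1 then y else x

theorem join_fst (x y : ℕ × V) : (join x y).1 = max x.1 y.1 := by
  unfold join
  split_ifs <;> omega

theorem join_eq_or (x y : ℕ × V) : join x y = x ∨ join x y = y := by
  unfold join
  split_ifs <;> simp

/-- What a process has to do before it receives the next message. -/
inductive Instr (S : Fin m → Set (Fin n)) : Type
  | write (i : Fin m) : Instr S
  | read (R : Reg S) : Instr S
  | send (q : Fin n) : Instr S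

/-- Contents of messages: the round of the sender, the pair that it stores, and the latest round of
the receiver that it knows of. -/
structure Packet (V : Type u) : Type u where
  round : ℕ
  pair : ℕ × V
  ack : ℕ

/-- Local states: the remaining instructions; the pair (timestamp, value) with the largest known
timestamp; the current round; the latest known round of every process; the latest own round that
every process acknowledged; how many rounds the current operation still needs; the pair that the
current operation returns. -/
structure Local (S : Fin m → Set (Fin n)) (V : Type u) : Type u where
  todo : List (Instr S)
  pair : ℕ × V
  round : ℕ
  seen : Fin n → ℕ
  acked : Fin n → ℕ
  left : ℕ
  res : ℕ × V

open Classical in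
/-- All accesses to registers, and then all messages to be sent. -/
noncomputable def program (S : Fin m → Set (Fin n)) (p : Fin n) : List (Instr S) :=
  ((Finset.univ.filter fun i => p ∈ S i).toList.map Instr.write ++
    (Finset.univ.filter fun R : Reg S => p ∈ S R.1.1).toList.map Instr.read) ++
  (Finset.univ : Finset (Fin n)).toList.map Instr.send

theorem write_mem_program {p : Fin n} {i : Fin m} :
    Instr.write i ∈ program S p ↔ p ∈ S i := by
  simp [program]

theorem read_mem_program {p : Fin n} {R : Reg S} :
    Instr.read R ∈ program S p ↔ p ∈ S R.1.1 := by
  simp [program]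

theorem send_mem_program {p q : Fin n} : Instr.send q ∈ program S p := by
  simp [program]

/-- Once a send has been reached, only sends remain. So an acknowledgement leaves a process only
after all register accesses of the pass. -/
theorem pairwise_program (p : Fin n) :
    (program S p).Pairwise fun a b => (∃ q, a = .send q) → ∃ q, b = .send q := by
  unfold program
  rw [List.pairwise_append]
  refine ⟨?_, ?_, ?_⟩
  · refine List.pairwise_of_forall_mem_list ?_
    rintro a ha b - ⟨q, rfl⟩
    simp at ha
  · refine List.pairwise_of_forall_mem_list ?_
    rintro a - b hb -
    simp only [List.mem_map] at hb
    obtain ⟨q, -, rfl⟩ := hb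
    exact ⟨q, rfl⟩
  · rintro a - b hb -
    simp only [List.mem_map] at hb
    obtain ⟨q, -, rfl⟩ := hb
    exact ⟨q, rfl⟩

/-- At least `n - t` processes acknowledged the current round. -/
def Local.Complete (t : ℕ) (s : Local S V) : Prop :=
  n - t ≤ (Finset.univ.filter fun q => s.round ≤ s.acked q).card

/-- The second round of an operation starts when the first one is complete. -/
noncomputable def Local.advance (t : ℕ) (s : Local S V) : Local S V :=
  open Classical in
  if s.left = 2 ∧ s.Complete t then { s with left := 1, res := s.pair, round := s.round + 1 } else s

/-- The effect of the packet `a` from `q`. -/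
def Local.receive (s : Local S V) (q : Fin n) (a : Packet V) : Local S V :=
  { s with
    pair := join s.pair a.pair
    seen := Function.update s.seen q (max (s.seen q) a.round)
    acked := Function.update s.acked q (max (s.acked q) a.ack) }

/-- The state after an attempt to receive a message. -/
noncomputable def Local.afterRecv (t : ℕ) (p : Fin n) (s : Local S V) :
    Option (Fin n × Packet V) → Local S V
  | none => { s.advance t with todo := program S p }
  | some (q, a) => { (s.advance t).receive q a with todo := program S p }

/-- The state after an operation is called. -/
def Local.afterCall (s : Local S V) : Op V → Local S V
  | .read => { s with round := s.round + 1, left := 2 }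
  | .write v => { s with round := s.round + 1, left := 2, pair := (s.pair.1 + 1, v) }

/-- The packet that a process in state `s` sends to `q`. -/
def Local.packet (s : Local S V) (q : Fin n) : Packet V := ⟨s.round, s.pair, s.seen q⟩

open Classical in
/-- The next step of process `p`. -/
noncomputable def Local.act (t : ℕ) (p : Fin n) (s : Local S V) :
    Action S V (Local S V) (Packet V) (ℕ × V) p :=
  match s.todo with
  | [] => if s.left = 1 ∧ s.Complete t then .ret s.res.2 { s with left := 0 }
      else .recv (s.afterRecv t p)
  | .write i :: l =>
    if h : p ∈ S i then .write i h s.pair { s with todo := l } else .recv fun _ => s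
  | .read R :: l =>
    if h : p ∈ S R.1.1 then .read R h fun x => { s with todo := l, pair := join s.pair x }
    else .recv fun _ => s
  | .send q :: l => .send q (s.packet q) { s with todo := l }

/-- The algorithm of Attiya, Bar-Noy and Dolev, where every process also forwards what it knows to
the processes with which it shares registers. -/
noncomputable abbrev protocol (S : Fin m → Set (Fin n)) {V : Type u} (t : ℕ) (v₀ : V) :
    Algorithm S V where
  State := Local S V
  Msg := Packet V
  Val := ℕ × V
  init _ := ⟨[], (0, v₀), 0, fun _ => 0, fun _ => 0, 0, (0, v₀)⟩
  regInit _ := (0, v₀)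
  call _ op s := s.afterCall op
  act p s := s.act t p

/-- Configurations of `protocol`. -/
structure World (S : Fin m → Set (Fin n)) (V : Type u) : Type u where
  state : Fin n → Local S V
  busy : Fin n → Bool
  net : Multiset (Fin n × Fin n × Packet V)
  regs : Reg S → ℕ × V

/-- The transitions of `protocol`. -/
inductive Trans (t : ℕ) (w : Fin n) : World S V → Event n V (Packet V) → World S V → Prop
  | idle (W : World S V) : Trans t w W .idle W
  | call (W : World S V) (p : Fin n) (op : Op V) (hw : ∀ v, op = .write v → p = w)
      (hb : W.busy p = false) :
      Trans t w W (.call p op)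
        ⟨Function.update W.state p ((W.state p).afterCall op), Function.update W.busy p true,
          W.net, W.regs⟩
  | send (W : World S V) (p q : Fin n) (l : List (Instr S)) (h : (W.state p).todo = .send q :: l) :
      Trans t w W (.internal p)
        ⟨Function.update W.state p { W.state p with todo := l }, W.busy,
          (p, q, (W.state p).packet q) ::ₘ W.net, W.regs⟩
  | recvNone (W : World S V) (p : Fin n) (h : (W.state p).todo = [])
      (hc : ¬ ((W.state p).left = 1 ∧ (W.state p).Complete t)) :
      Trans t w W (.recv p none)
        ⟨Function.update W.state p ((W.state p).afterRecv t p none), W.busy, W.net, W.regs⟩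
  | recvSome (W : World S V) (p q : Fin n) (a : Packet V)
      (net : Multiset (Fin n × Fin n × Packet V)) (h : (W.state p).todo = [])
      (hc : ¬ ((W.state p).left = 1 ∧ (W.state p).Complete t)) (hnet : W.net = (q, p, a) ::ₘ net) :
      Trans t w W (.recv p (some (q, a)))
        ⟨Function.update W.state p ((W.state p).afterRecv t p (some (q, a))), W.busy, net, W.regs⟩
  | read (W : World S V) (p : Fin n) (R : Reg S) (l : List (Instr S)) (hp : p ∈ S R.1.1)
      (h : (W.state p).todo = .read R :: l) :
      Trans t w W (.internal p)
        ⟨Function.update W.state p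
          { W.state p with todo := l, pair := join (W.state p).pair (W.regs R) },
          W.busy, W.net, W.regs⟩
  | write (W : World S V) (p : Fin n) (i : Fin m) (l : List (Instr S)) (hp : p ∈ S i)
      (h : (W.state p).todo = .write i :: l) :
      Trans t w W (.internal p)
        ⟨Function.update W.state p { W.state p with todo := l }, W.busy, W.net,
          Function.update W.regs ⟨(i, p), hp⟩ (W.state p).pair⟩
  | ret (W : World S V) (p : Fin n) (h : (W.state p).todo = []) (hl : (W.state p).left = 1)
      (hc : (W.state p).Complete t) :
      Trans t w W (.ret p (W.state p).res.2)
        ⟨Function.update W.state p { W.state p with left := 0 }, Function.update W.busy p false,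
          W.net, W.regs⟩

/-- The configuration `C` as a `World`. -/
def view {t : ℕ} {v₀ : V} (C : Config (protocol S t v₀)) : World S V :=
  ⟨C.state, C.busy, C.net, C.regs⟩

theorem todo_afterRecv (t : ℕ) (p : Fin n) (s : Local S V) (o : Option (Fin n × Packet V)) :
    (s.afterRecv t p o).todo = program S p := by
  rcases o with _ | ⟨q, a⟩ <;> rfl

theorem todo_afterCall (s : Local S V) (op : Op V) : (s.afterCall op).todo = s.todo := by
  cases op <;> rfl

/-- The `recv` branches of `Local.act` for forbidden registers exist only to make the function
total. They are unreachable while `todo` is a suffix of the program, which is why `Trans` omits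
them. -/
theorem Step.trans_view {t : ℕ} {v₀ : V} {w : Fin n} {C C' : Config (protocol S t v₀)}
    {e : Event n V (protocol S t v₀).Msg} (h : Step (protocol S t v₀) w C e C')
    (hC : ∀ p, (C.state p).todo <:+ program S p) : Trans t w (view C) e (view C') := by
  have hpos : ∀ p a l, (C.state p).todo = a :: l → a ∈ program S p := fun p a l h =>
    (hC p).subset (by simp [h])
  have hact : ∀ p, (protocol S t v₀).act p (C.state p) = (C.state p).act t p := fun p => rfl
  cases h with
  | idle => exact Trans.idle _
  | call p op hw hb => exact Trans.call (view C) p op hw hb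
  | send p q a s h =>
    rw [hact, Local.act] at h
    split at h <;> (try split_ifs at h) <;> cases h
    exact Trans.send (view C) p q _ ‹_›
  | recvNone p k h =>
    rw [hact, Local.act] at h
    split at h <;> (try split_ifs at h with hh) <;> cases h
    · exact Trans.recvNone (view C) p ‹_› hh
    · exact absurd (write_mem_program.1 (hpos _ _ _ ‹_›)) hh
    · exact absurd (read_mem_program.1 (hpos _ _ _ ‹_›)) hh
  | recvSome p q a net' k h hnet =>
    rw [hact, Local.act] at h
    split at h <;> (try split_ifs at h with hh) <;> cases h
    · exact Trans.recvSome (view C) p q a net' ‹_› hh hnet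
    · exact absurd (write_mem_program.1 (hpos _ _ _ ‹_›)) hh
    · exact absurd (read_mem_program.1 (hpos _ _ _ ‹_›)) hh
  | read p R hp k h =>
    rw [hact, Local.act] at h
    split at h <;> (try split_ifs at h) <;> cases h
    exact Trans.read (view C) p R _ hp ‹_›
  | write p i hp x s h =>
    rw [hact, Local.act] at h
    split at h <;> (try split_ifs at h) <;> cases h
    exact Trans.write (view C) p i _ hp ‹_›
  | ret p v s h =>
    rw [hact, Local.act] at h
    split at h <;> (try split_ifs at h with hh) <;> cases h
    exact Trans.ret (view C) p ‹_› hh.1 hh.2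

/-- The initial `World`. -/
def World.initial (S : Fin m → Set (Fin n)) (v₀ : V) : World S V :=
  ⟨fun _ => ⟨[], (0, v₀), 0, fun _ => 0, fun _ => 0, 0, (0, v₀)⟩, fun _ => false, 0,
    fun _ => (0, v₀)⟩

/-- Every process is in the course of its program. -/
def World.OnTrack (W : World S V) : Prop := ∀ p, (W.state p).todo <:+ program S p

theorem forall_update {α β : Type*} [DecidableEq α] {f : α → β} {P : α → β → Prop} {a : α} {b : β}
    (h : ∀ x, P x (f x)) (hb : P a b) : ∀ x, P x (Function.update f a b x) := by
  intro x
  rcases eq_or_ne x a with rfl | hx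
  · simpa
  · simpa [hx] using h x

theorem Trans.onTrack {t : ℕ} {w : Fin n} {W W' : World S V} {e : Event n V (Packet V)}
    (h : Trans t w W e W') (hW : W.OnTrack) : W'.OnTrack := by
  have hcons : ∀ p a l, (W.state p).todo = a :: l → l <:+ program S p := fun p a l h =>
    (List.suffix_cons a l).trans (h ▸ hW p)
  cases h with
  | idle => exact hW
  | call p op hw hb =>
    exact forall_update (P := fun p (s : Local S V) => s.todo <:+ program S p) hW
      (by rw [todo_afterCall]; exact hW p)
  | recvNone p h hc =>
    exact forall_update (P := fun p (s : Local S V) => s.todo <:+ program S p) hW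
      (by rw [todo_afterRecv])
  | recvSome p q a net h hc hnet =>
    exact forall_update (P := fun p (s : Local S V) => s.todo <:+ program S p) hW
      (by rw [todo_afterRecv])
  | ret p h hl hc => exact forall_update (P := fun p (s : Local S V) => s.todo <:+ program S p) hW (hW p)
  | send p q l h =>
    exact forall_update (P := fun p (s : Local S V) => s.todo <:+ program S p) hW (hcons p _ l h)
  | read p R l hp h =>
    exact forall_update (P := fun p (s : Local S V) => s.todo <:+ program S p) hW (hcons p _ l h)
  | write p i l hp h =>
    exact forall_update (P := fun p (s : Local S V) => s.todo <:+ program S p) hW (hcons p _ l h)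

theorem Run.onTrack_and_trans {t : ℕ} {v₀ : V} {w : Fin n} (r : Run (protocol S t v₀) w) :
    (∀ k, (view (r.cfg k)).OnTrack) ∧
      ∀ k, Trans t w (view (r.cfg k)) (r.ev k) (view (r.cfg (k + 1))) := by
  have h : ∀ k, (view (r.cfg k)).OnTrack := by
    intro k
    induction k with
    | zero =>
      rw [r.cfg_zero]
      exact fun p => List.nil_suffix
    | succ k ih => exact ((r.step k).trans_view ih).onTrack ih
  exact ⟨h, fun k => (r.step k).trans_view (h k)⟩

end Protocol
-- Safety: monotonicity of timestamps, origin of knowledge, and what an acknowledgement certifies.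
section Safety

variable {n m : ℕ} {S : Fin m → Set (Fin n)} {V : Type u}

section Fields

variable (t : ℕ) (p q q' : Fin n) (s : Local S V) (a : Packet V) (op : Op V)

@[simp] theorem seen_afterCall : (s.afterCall op).seen = s.seen := by cases op <;> rfl
@[simp] theorem acked_afterCall : (s.afterCall op).acked = s.acked := by cases op <;> rfl
@[simp] theorem round_afterCall : (s.afterCall op).round = s.round + 1 := by cases op <;> rfl
@[simp] theorem left_afterCall : (s.afterCall op).left = 2 := by cases op <;> rfl
@[simp] theorem res_afterCall : (s.afterCall op).res = s.res := by cases op <;> rfl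

theorem pair_le_pair_afterCall : s.pair.1 ≤ (s.afterCall op).pair.1 := by
  cases op <;> simp [Local.afterCall]

@[simp] theorem seen_advance : (s.advance t).seen = s.seen := by
  unfold Local.advance; split_ifs <;> rfl
@[simp] theorem acked_advance : (s.advance t).acked = s.acked := by
  unfold Local.advance; split_ifs <;> rfl
@[simp] theorem pair_advance : (s.advance t).pair = s.pair := by
  unfold Local.advance; split_ifs <;> rfl

theorem round_le_round_advance : s.round ≤ (s.advance t).round := by
  unfold Local.advance; split_ifs <;> simp

@[simp] theorem seen_afterRecv_none : (s.afterRecv t p none).seen = s.seen := seen_advance t s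
@[simp] theorem acked_afterRecv_none : (s.afterRecv t p none).acked = s.acked := acked_advance t s
@[simp] theorem pair_afterRecv_none : (s.afterRecv t p none).pair = s.pair := pair_advance t s
@[simp] theorem round_afterRecv (o : Option (Fin n × Packet V)) :
    (s.afterRecv t p o).round = (s.advance t).round := by rcases o with _ | ⟨q, a⟩ <;> rfl
@[simp] theorem left_afterRecv (o : Option (Fin n × Packet V)) :
    (s.afterRecv t p o).left = (s.advance t).left := by rcases o with _ | ⟨q, a⟩ <;> rfl
@[simp] theorem res_afterRecv (o : Option (Fin n × Packet V)) :
    (s.afterRecv t p o).res = (s.advance t).res := by rcases o with _ | ⟨q, a⟩ <;> rfl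

@[simp] theorem seen_afterRecv_some : (s.afterRecv t p (some (q, a))).seen q' =
    if q' = q then max (s.seen q) a.round else s.seen q' := by
  simp [Local.afterRecv, Local.receive, Function.update_apply]
@[simp] theorem acked_afterRecv_some : (s.afterRecv t p (some (q, a))).acked q' =
    if q' = q then max (s.acked q) a.ack else s.acked q' := by
  simp [Local.afterRecv, Local.receive, Function.update_apply]
@[simp] theorem pair_afterRecv_some :
    (s.afterRecv t p (some (q, a))).pair = join s.pair a.pair := by
  simp [Local.afterRecv, Local.receive]

end Fields

/-- The basic invariants. -/
structure World.Basic (W : World S V) : Prop where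
  onTrack : W.OnTrack
  left_eq : ∀ p, (W.busy p = true → (W.state p).left = 1 ∨ (W.state p).left = 2) ∧
    (W.busy p = false → (W.state p).left = 0)
  reg_le : ∀ R : Reg S, (W.regs R).1 ≤ (W.state R.1.2).pair.1

variable {t : ℕ} {w : Fin n} {W W' : World S V} {e : Event n V (Packet V)}

theorem Trans.pair_mono (h : Trans t w W e W') (p : Fin n) :
    (W.state p).pair.1 ≤ (W'.state p).pair.1 := by
  cases h with
  | idle => rfl
  | call p' op =>
    have := pair_le_pair_afterCall (W.state p) op
    simp only [Function.update_apply]; split_ifs with h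
    · subst h; exact this
    · rfl
  | _ =>
    simp only [Function.update_apply]; split_ifs with h
    · subst h; simp [join_fst]
    · rfl

/-- By `reg_le`, the single writer of a register holds a timestamp at least as large as the one
stored there, so overwriting cannot lower it. -/
theorem Trans.regs_mono (h : Trans t w W e W') (hW : W.Basic) (R : Reg S) :
    (W.regs R).1 ≤ (W'.regs R).1 := by
  cases h with
  | write p i l hp h =>
    simp only [Function.update_apply]
    split_ifs with h
    · subst h
      exact hW.reg_le _
    · rfl
  | _ => rfl

theorem left_advance (s : Local S V) (h : s.left = 1 ∨ s.left = 2) :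
    (s.advance t).left = 1 ∨ (s.advance t).left = 2 := by
  unfold Local.advance
  split_ifs <;> simp [h]

theorem left_advance_of_zero (s : Local S V) (h : s.left = 0) : (s.advance t).left = 0 := by
  unfold Local.advance
  split_ifs with hh
  · omega
  · exact h

theorem Trans.basic (h : Trans t w W e W') (hW : W.Basic) : W'.Basic := by
  refine ⟨h.onTrack hW.onTrack, fun p => ?_, fun R => ?_⟩
  · have hp := hW.left_eq p
    have h1 := left_advance (t := t) (W.state p)
    have h2 := left_advance_of_zero (t := t) (W.state p)
    cases h with
    | idle => exact hp
    | _ =>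
      simp only [Function.update_apply]
      split_ifs with h
      · subst h
        simp_all
      · exact hp
  · have hR := (hW.reg_le R).trans (h.pair_mono R.1.2)
    cases h with
    | write p i l hp h =>
      simp only [Function.update_apply] at hR ⊢
      split_ifs with h1 h2 h2
      · rfl
      · subst h1; simp at h2
      · simpa [h2] using hR
      · simpa [h2] using hR
    | _ => exact hR

theorem Trans.acked_cases (h : Trans t w W e W') {p q : Fin n} {k : ℕ}
    (hk : k ≤ (W'.state q).acked p) : k ≤ (W.state q).acked p ∨
      ∃ a, (p, q, a) ∈ W.net ∧ k ≤ a.ack ∧ a.pair.1 ≤ (W'.state q).pair.1 := by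
  cases h with
  | idle => exact Or.inl hk
  | recvSome p' q' a' net h hc hnet =>
    simp only [Function.update_apply] at hk ⊢
    split_ifs at hk ⊢ with hh
    · subst hh
      simp only [acked_afterRecv_some] at hk
      split_ifs at hk with hh
      · subst hh
        rcases le_max_iff.1 hk with hk | hk
        · exact Or.inl hk
        · exact Or.inr ⟨a', by simp [hnet], hk, by simp [join_fst]⟩
      · exact Or.inl hk
    · exact Or.inl hk
  | _ =>
    left
    simp only [Function.update_apply] at hk
    split_ifs at hk with hh
    · subst hh
      simpa using hk
    · exact hk

/-- New knowledge comes from a packet, and receiving one restarts the whole program. The last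
conjunct is the reason why an acknowledgement vouches for register accesses made after the round was
heard of. -/
theorem Trans.seen_cases (h : Trans t w W e W') {p q : Fin n} {k : ℕ}
    (hk : k ≤ (W'.state p).seen q) : k ≤ (W.state p).seen q ∨
      ∃ a, (q, p, a) ∈ W.net ∧ k ≤ a.round ∧ a.pair.1 ≤ (W'.state p).pair.1 ∧
        (W'.state p).todo = program S p := by
  cases h with
  | idle => exact Or.inl hk
  | recvSome p' q' a' net h hc hnet =>
    simp only [Function.update_apply] at hk ⊢
    split_ifs at hk ⊢ with hh
    · subst hh
      simp only [seen_afterRecv_some] at hk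
      split_ifs at hk with hh
      · subst hh
        rcases le_max_iff.1 hk with hk | hk
        · exact Or.inl hk
        · exact Or.inr ⟨a', by simp [hnet], hk, by simp [join_fst], todo_afterRecv _ _ _ _⟩
      · exact Or.inl hk
    · exact Or.inl hk
  | _ =>
    left
    simp only [Function.update_apply] at hk
    split_ifs at hk with hh
    · subst hh
      simpa using hk
    · exact hk

theorem Trans.net_cases (h : Trans t w W e W') {p q : Fin n} {a : Packet V}
    (ha : (p, q, a) ∈ W'.net) : (p, q, a) ∈ W.net ∨
      a = (W.state p).packet q ∧ ∃ l, (W.state p).todo = .send q :: l := by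
  cases h with
  | send p' q' l h =>
    simp only [Multiset.mem_cons, Prod.mk.injEq] at ha
    rcases ha with ⟨rfl, rfl, rfl⟩ | ha
    · exact Or.inr ⟨rfl, l, h⟩
    · exact Or.inl ha
  | recvSome p' q' a' net h hc hnet => exact Or.inl (by simp [hnet, ha])
  | _ => exact Or.inl ha

/-- An instruction leaves `todo` only by being executed, because a new pass starts only from an
empty list. -/
theorem Trans.write_cases (h : Trans t w W e W') {R : Reg S}
    (hR : .write R.1.1 ∈ (W.state R.1.2).todo) :
    .write R.1.1 ∈ (W'.state R.1.2).todo ∨ (W.state R.1.2).pair.1 ≤ (W'.regs R).1 := by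
  cases h with
  | idle => exact Or.inl hR
  | write p i l hp h =>
    by_cases hp : R.1.2 = p
    · subst hp
      simp only [h, List.mem_cons, Instr.write.injEq] at hR
      rcases hR with hR | hR
      · subst hR
        exact Or.inr (by simp)
      · exact Or.inl (by simpa using hR)
    · exact Or.inl (by simpa [hp] using hR)
  | _ =>
    left
    simp only [Function.update_apply]
    split_ifs with hh
    · simp_all [todo_afterCall]
    · exact hR

theorem Trans.read_cases (h : Trans t w W e W') {p : Fin n} {R : Reg S}
    (hR : .read R ∈ (W.state p).todo) :
    .read R ∈ (W'.state p).todo ∨ (W.regs R).1 ≤ (W'.state p).pair.1 := by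
  cases h with
  | idle => exact Or.inl hR
  | read p' R' l hp h =>
    by_cases hp : p = p'
    · subst hp
      simp only [h, List.mem_cons, Instr.read.injEq] at hR
      rcases hR with hR | hR
      · subst hR
        exact Or.inr (by simp [join_fst])
      · exact Or.inl (by simpa using hR)
    · exact Or.inl (by simpa [hp] using hR)
  | _ =>
    left
    simp only [Function.update_apply]
    split_ifs with hh
    · simp_all [todo_afterCall]
    · exact hR

/-! ### Rounds -/

/-- No process has heard of a round of `q` after round `k`. -/
structure World.Below (q : Fin n) (k : ℕ) (W : World S V) : Prop where
  seen : ∀ p, (W.state p).seen q ≤ k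
  acked : ∀ p, (W.state q).acked p ≤ k
  req : ∀ p a, (q, p, a) ∈ W.net → a.round ≤ k
  ack : ∀ p a, (p, q, a) ∈ W.net → a.ack ≤ k

theorem Trans.round_mono (h : Trans t w W e W') (p : Fin n) :
    (W.state p).round ≤ (W'.state p).round := by
  have := round_le_round_advance t (W.state p)
  cases h with
  | idle => rfl
  | _ =>
    simp only [Function.update_apply]; split_ifs with h
    · subst h; simp [*]
    · rfl

theorem Trans.below (h : Trans t w W e W') {q : Fin n} {k : ℕ} (hW : W.Below q k)
    (hk : (W.state q).round ≤ k) : W'.Below q k := by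
  refine ⟨fun p => ?_, fun p => ?_, fun p a ha => ?_, fun p a ha => ?_⟩
  · rcases h.seen_cases le_rfl with h | ⟨a, ha, h, -⟩
    · exact h.trans (hW.seen p)
    · exact h.trans (hW.req p a ha)
  · rcases h.acked_cases le_rfl with h | ⟨a, ha, h, -⟩
    · exact h.trans (hW.acked p)
    · exact h.trans (hW.ack p a ha)
  · rcases h.net_cases ha with ha | ⟨rfl, -⟩
    · exact hW.req p a ha
    · exact hk
  · rcases h.net_cases ha with ha | ⟨rfl, -⟩
    · exact hW.ack p a ha
    · exact hW.seen p

/-- A round `k` of `q` that started with a timestamp at least `z`, when the timestamps in the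
registers were at least `ρ`. -/
structure World.InRound (q : Fin n) (k z : ℕ) (ρ : Reg S → ℕ) (W : World S V) : Prop where
  pair : z ≤ (W.state q).pair.1
  regs : ∀ R, ρ R ≤ (W.regs R).1
  req : ∀ p a, (q, p, a) ∈ W.net → k ≤ a.round → z ≤ a.pair.1
  seen : ∀ p, k ≤ (W.state p).seen q → z ≤ (W.state p).pair.1 ∧
    (∀ R : Reg S, R.1.2 = p → .write R.1.1 ∈ (W.state p).todo ∨ z ≤ (W.regs R).1) ∧
    ∀ R : Reg S, p ∈ S R.1.1 → .read R ∈ (W.state p).todo ∨ ρ R ≤ (W.state p).pair.1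
  ack : ∀ p a, (p, q, a) ∈ W.net → k ≤ a.ack →
    (∀ R : Reg S, R.1.2 = p → z ≤ (W.regs R).1) ∧ ∀ R : Reg S, p ∈ S R.1.1 → ρ R ≤ a.pair.1
  acked : ∀ p, k ≤ (W.state q).acked p →
    (∀ R : Reg S, R.1.2 = p → z ≤ (W.regs R).1) ∧
      ∀ R : Reg S, p ∈ S R.1.1 → ρ R ≤ (W.state q).pair.1

/-- A fresh round number occurs nowhere yet, so all clauses about packets and counters hold
vacuously. -/
theorem World.Below.inRound {q : Fin n} {k z : ℕ} {ρ : Reg S → ℕ} (h : W.Below q k)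
    (hz : z ≤ (W.state q).pair.1) (hρ : ∀ R, ρ R ≤ (W.regs R).1) : W.InRound q (k + 1) z ρ := by
  obtain ⟨h1, h2, h3, h4⟩ := h
  exact ⟨hz, hρ, fun p a ha hk => by have := h3 p a ha; omega,
    fun p hk => by have := h1 p; omega, fun p a ha hk => by have := h4 p a ha; omega,
    fun p hk => by have := h2 p; omega⟩

theorem not_mem_of_send {p q : Fin n} {l : List (Instr S)} (h : .send q :: l <:+ program S p) :
    (∀ i, .write i ∉ l) ∧ ∀ R, .read R ∉ l := by
  have h1 := (pairwise_program p).sublist h.sublist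
  rw [List.pairwise_cons] at h1
  constructor
  · intro i hi
    obtain ⟨q, hq⟩ := h1.1 _ hi ⟨q, rfl⟩
    cases hq
  · intro i hi
    obtain ⟨q, hq⟩ := h1.1 _ hi ⟨q, rfl⟩
    cases hq

/-- The guarantees follow the path of information: the request carries `z`, the process that hears
of it owes a full pass of writes and reads, its acknowledgement is sent once nothing is owed, and
`q` absorbs the pair that comes with it. Monotonicity of pairs and registers preserves what has been
reached. -/
theorem Trans.inRound (h : Trans t w W e W') {q : Fin n} {k z : ℕ} {ρ : Reg S → ℕ}
    (hB : W.Basic) (hW : W.InRound q k z ρ) : W'.InRound q k z ρ := by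
  have hr := h.regs_mono hB
  have hp := h.pair_mono
  refine ⟨hW.pair.trans (hp q), fun R => (hW.regs R).trans (hr R), fun p a ha hk => ?_,
    fun p hk => ?_, fun p a ha hk => ?_, fun p hk => ?_⟩
  · rcases h.net_cases ha with ha | ⟨rfl, -⟩
    · exact hW.req p a ha hk
    · exact hW.pair
  · rcases h.seen_cases hk with hk | ⟨a, ha, hk, hap, htodo⟩
    · obtain ⟨h1, h2, h3⟩ := hW.seen p hk
      refine ⟨h1.trans (hp p), fun R hR => ?_, fun R hR => ?_⟩
      · subst hR
        rcases h2 R rfl with hm | hm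
        · rcases h.write_cases hm with hm | hm
          · exact Or.inl hm
          · exact Or.inr (h1.trans hm)
        · exact Or.inr (hm.trans (hr R))
      · rcases h3 R hR with hm | hm
        · rcases h.read_cases hm with hm | hm
          · exact Or.inl hm
          · exact Or.inr ((hW.regs R).trans hm)
        · exact Or.inr (hm.trans (hp p))
    -- Just after `p` hears of the round, every access is still to come.
    · rw [htodo]
      refine ⟨(hW.req p a ha hk).trans hap, fun R hR => Or.inl ?_, fun R hR => Or.inl ?_⟩
      · subst hR
        exact write_mem_program.2 R.2
      · exact read_mem_program.2 hR
  · suffices hs : (∀ R : Reg S, R.1.2 = p → z ≤ (W.regs R).1) ∧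
        ∀ R : Reg S, p ∈ S R.1.1 → ρ R ≤ a.pair.1 from
      ⟨fun R hR => (hs.1 R hR).trans (hr R), hs.2⟩
    rcases h.net_cases ha with ha | ⟨rfl, l, hl⟩
    · exact hW.ack p a ha hk
    -- The packet is being sent, so no access is pending and only the second alternatives of
    -- `hW.seen` survive.
    · obtain ⟨h6, h7⟩ := not_mem_of_send (hl ▸ hB.onTrack p)
      obtain ⟨-, h9, h10⟩ := hW.seen p hk
      simp only [hl, List.mem_cons, reduceCtorEq, h6, h7, false_or] at h9 h10
      exact ⟨h9, h10⟩
  · rcases h.acked_cases hk with hk | ⟨a, ha, hk, hap⟩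
    · exact ⟨fun R hR => ((hW.acked p hk).1 R hR).trans (hr R),
        fun R hR => ((hW.acked p hk).2 R hR).trans (hp q)⟩
    · exact ⟨fun R hR => ((hW.ack p a ha hk).1 R hR).trans (hr R),
        fun R hR => ((hW.ack p a ha hk).2 R hR).trans hap⟩

end Safety
-- Atomicity: the two rounds of an operation, and timestamps as indices of writes.
section Atomicity

variable {n m : ℕ} {S : Fin m → Set (Fin n)} {V : Type u}
variable {t : ℕ} {w : Fin n} {W W' : World S V} {e : Event n V (Packet V)}

/-- `Q` is a set of at least `n - t` processes whose registers have timestamps at least `z`. -/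
def Stored (t z : ℕ) (ρ : Reg S → ℕ × V) : Prop :=
  ∃ Q : Finset (Fin n), n - t ≤ Q.card ∧ ∀ R : Reg S, R.1.2 ∈ Q → z ≤ (ρ R).1

/-- `z` is at least as large as the timestamps that some `n - t` processes can read. -/
def Gathered (t z : ℕ) (ρ : Reg S → ℕ × V) : Prop :=
  ∃ Q : Finset (Fin n), n - t ≤ Q.card ∧ ∀ p ∈ Q, ∀ R : Reg S, p ∈ S R.1.1 → (ρ R).1 ≤ z

/-- An operation of `q` that started in round `k`, with a timestamp at least `z`, when the registers
had the values `ρ`, is in progress. -/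
def World.InOp (t : ℕ) (q : Fin n) (k z : ℕ) (ρ : Reg S → ℕ × V) (W : World S V) : Prop :=
  ((W.state q).left = 2 ∧ (W.state q).round = k ∧ W.InRound q k z fun R => (ρ R).1) ∨
  ((W.state q).left = 1 ∧ z ≤ (W.state q).res.1 ∧ Gathered t (W.state q).res.1 ρ ∧
    W.InRound q (W.state q).round (W.state q).res.1 fun _ => 0)

theorem advance_cases (s : Local S V) :
    s.advance t = s ∨ s.left = 2 ∧ s.Complete t ∧
      s.advance t = { s with left := 1, res := s.pair, round := s.round + 1 } := by
  unfold Local.advance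
  split_ifs with h
  · exact Or.inr ⟨h.1, h.2, rfl⟩
  · exact Or.inl rfl

/-- A nonzero `left` means that `q` is busy, so no call can interfere at `q`. Returns being excluded
by `he`, only the passage to the second round can change these fields. -/
theorem Trans.left_cases (h : Trans t w W e W') (hB : W.Basic) {q : Fin n}
    (hq : (W.state q).left ≠ 0) (he : ∀ v, e ≠ .ret q v) :
    ((W'.state q).left = (W.state q).left ∧ (W'.state q).round = (W.state q).round ∧
      (W'.state q).res = (W.state q).res) ∨
    ((W.state q).left = 2 ∧ (W.state q).Complete t ∧ (W'.state q).left = 1 ∧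
      (W'.state q).round = (W.state q).round + 1 ∧ (W'.state q).res = (W.state q).pair ∧
      (W.state q).todo = [] ∧ e.IsStepOf q) := by
  have hadv := advance_cases (t := t) (W.state q)
  cases h with
  | call p op hw hb =>
    have hpq : q ≠ p := by
      rintro rfl
      exact hq ((hB.left_eq q).2 hb)
    simp [hpq]
  | ret p h hl hc =>
    have hpq : q ≠ p := by
      rintro rfl
      exact he _ rfl
    simp [hpq]
  | recvNone p h hc =>
    by_cases hpq : q = p
    · subst hpq
      rcases hadv with h1 | ⟨h1, h2, h3⟩
      · simp [h1]
      · right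
        simp [h1, h2, h3, h, Event.IsStepOf]
    · simp [hpq]
  | recvSome p q' a net h hc hnet =>
    by_cases hpq : q = p
    · subst hpq
      rcases hadv with h1 | ⟨h1, h2, h3⟩
      · simp [h1]
      · right
        simp [h1, h2, h3, h, Event.IsStepOf]
    · simp [hpq]
  | idle => exact Or.inl ⟨rfl, rfl, rfl⟩
  | _ =>
    left
    simp only [Function.update_apply]
    split_ifs <;> simp_all

/-- When the first round is complete, the processes that acknowledged it are the gathering quorum,
and the current pair becomes `res`. The second round starts afresh with the timestamp of `res`; it
only has to store, hence the trivial bound `0` on what is read. -/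
theorem Trans.inOp (h : Trans t w W e W') (hB : W.Basic) {q : Fin n} {k z : ℕ}
    {ρ : Reg S → ℕ × V} (hb : W.Below q (W.state q).round) (hW : W.InOp t q k z ρ)
    (he : ∀ v, e ≠ .ret q v) : W'.InOp t q k z ρ := by
  rcases hW with ⟨h1, h2, h3⟩ | ⟨h1, h2, h3, h4⟩
  · rcases h.left_cases hB (by omega) he with ⟨h4, h5, h6⟩ | ⟨-, h5, h6, h7, h8, -⟩
    · exact Or.inl ⟨h4.trans h1, h5.trans h2, h.inRound hB h3⟩
    · refine Or.inr ⟨h6, ?_, ?_, ?_⟩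
      · rw [h8]
        exact h3.pair
      · rw [h8]
        refine ⟨_, h5, fun p hp R hR => (h3.acked p ?_).2 R hR⟩
        rw [← h2]
        exact (Finset.mem_filter.1 hp).2
      · rw [h7, h8]
        exact (h.below hb le_rfl).inRound (h.pair_mono q) fun _ => Nat.zero_le _
  · rcases h.left_cases hB (by omega) he with ⟨h5, h6, h7⟩ | ⟨h5, -⟩
    · right
      rw [h5, h6, h7]
      exact ⟨h1, h2, h3, h.inRound hB h4⟩
    · omega

theorem World.InOp.stored {q : Fin n} {k z : ℕ} {ρ : Reg S → ℕ × V} (hW : W.InOp t q k z ρ)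
    (hl : (W.state q).left = 1) (hc : (W.state q).Complete t) :
    z ≤ (W.state q).res.1 ∧ Gathered t (W.state q).res.1 ρ ∧
      Stored t (W.state q).res.1 W.regs := by
  rcases hW with ⟨h1, -⟩ | ⟨-, h2, h3, h4⟩
  · omega
  · exact ⟨h2, h3, _, hc, fun R hR => (h4.acked _ (Finset.mem_filter.1 hR).2).1 R rfl⟩

/-- All pairs that occur in `W` satisfy `P`. -/
structure World.AllPairs (P : ℕ × V → Prop) (W : World S V) : Prop where
  pair : ∀ p, P (W.state p).pair
  res : ∀ p, P (W.state p).res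
  net : ∀ x ∈ W.net, P x.2.2.pair
  regs : ∀ R, P (W.regs R)

theorem Trans.allPairs (h : Trans t w W e W') {P : ℕ × V → Prop} (hW : W.AllPairs P)
    (he : ∀ p v, e = .call p (.write v) → P ((W.state p).pair.1 + 1, v)) : W'.AllPairs P := by
  obtain ⟨h1, h2, h3, h4⟩ := hW
  have hjoin : ∀ x y, P x → P y → P (join x y) := by
    intro x y hx hy
    rcases join_eq_or x y with h | h <;> rw [h] <;> assumption
  have hres : ∀ p, P ((W.state p).advance t).res := by
    intro p
    rcases advance_cases (t := t) (W.state p) with h | ⟨-, -, h⟩ <;> rw [h]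
    · exact h2 p
    · exact h1 p
  have hupd : ∀ (p : Fin n) (s : Local S V), P s.pair → P s.res →
      (∀ q, P (Function.update W.state p s q).pair) ∧
        ∀ q, P (Function.update W.state p s q).res := fun p s hs hs' =>
    ⟨forall_update (P := fun _ (s : Local S V) => P s.pair) h1 hs,
      forall_update (P := fun _ (s : Local S V) => P s.res) h2 hs'⟩
  cases h with
  | idle => exact ⟨h1, h2, h3, h4⟩
  | call p op hw hb =>
    have hs : P ((W.state p).afterCall op).pair := by
      cases op with
      | read => exact h1 p
      | write v => exact he p v rfl
    obtain ⟨h5, h6⟩ := hupd p ((W.state p).afterCall op) hs (by simpa using h2 p)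
    exact ⟨h5, h6, h3, h4⟩
  | send p q l h =>
    obtain ⟨h5, h6⟩ := hupd p { W.state p with todo := l } (h1 p) (h2 p)
    refine ⟨h5, h6, fun x hx => ?_, h4⟩
    rcases Multiset.mem_cons.1 hx with rfl | hx
    · exact h1 p
    · exact h3 x hx
  | recvNone p h hc =>
    obtain ⟨h5, h6⟩ := hupd p ((W.state p).afterRecv t p none) (by simpa using h1 p)
      (by simpa using hres p)
    exact ⟨h5, h6, h3, h4⟩
  | recvSome p q a net h hc hnet =>
    obtain ⟨h5, h6⟩ := hupd p ((W.state p).afterRecv t p (some (q, a)))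
      (by simpa using hjoin _ _ (h1 p) (h3 (q, p, a) (by simp [hnet]))) (by simpa using hres p)
    exact ⟨h5, h6, fun x hx => h3 x (by simp [hnet, hx]), h4⟩
  | read p R l hp h =>
    obtain ⟨h5, h6⟩ := hupd p { W.state p with
      todo := l, pair := join (W.state p).pair (W.regs R) } (hjoin _ _ (h1 p) (h4 R)) (h2 p)
    exact ⟨h5, h6, h3, h4⟩
  | write p i l hp h =>
    obtain ⟨h5, h6⟩ := hupd p { W.state p with todo := l } (h1 p) (h2 p)
    exact ⟨h5, h6, h3, forall_update (P := fun _ x => P x) h4 (h1 p)⟩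
  | ret p h hl hc =>
    obtain ⟨h5, h6⟩ := hupd p { W.state p with left := 0 } (h1 p) (h2 p)
    exact ⟨h5, h6, h3, h4⟩

theorem Trans.of_call {p : Fin n} {op : Op V} (h : Trans t w W (.call p op) W') :
    (∀ v, op = .write v → p = w) ∧ W'.state p = (W.state p).afterCall op ∧ W'.regs = W.regs := by
  cases h with
  | call _ _ hw hb => exact ⟨hw, by simp, rfl⟩

theorem Trans.of_ret {p : Fin n} {v : V} (h : Trans t w W (.ret p v) W') :
    (W.state p).left = 1 ∧ (W.state p).Complete t ∧ v = (W.state p).res.2 ∧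
      (W.state p).todo = [] := by
  cases h with
  | ret _ h hl hc => exact ⟨hl, hc, rfl, h⟩

namespace Run

variable {v₀ : V} (r : Run (protocol S t v₀) w)

/-- The configuration at time `k`, as a `World`. -/
def world (k : ℕ) : World S V := view (r.cfg k)

theorem trans_world (k : ℕ) : Trans t w (r.world k) (r.ev k) (r.world (k + 1)) :=
  r.onTrack_and_trans.2 k

theorem world_zero : r.world 0 = World.initial S v₀ := by
  rw [world, r.cfg_zero]
  rfl

theorem basic_world (k : ℕ) : (r.world k).Basic := by
  induction k with
  | zero =>
    rw [world_zero]
    exact ⟨fun p => List.nil_suffix, fun p => by simp [World.initial], fun R => le_rfl⟩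
  | succ k ih => exact (r.trans_world k).basic ih

theorem below_world (k : ℕ) (q : Fin n) : (r.world k).Below q ((r.world k).state q).round := by
  induction k with
  | zero =>
    rw [world_zero]
    exact ⟨fun p => le_rfl, fun p => le_rfl, by simp [World.initial], by simp [World.initial]⟩
  | succ k ih =>
    obtain ⟨h1, h2, h3, h4⟩ := (r.trans_world k).below ih le_rfl
    have h := (r.trans_world k).round_mono q
    exact ⟨fun p => (h1 p).trans h, fun p => (h2 p).trans h, fun p a ha => (h3 p a ha).trans h,
      fun p a ha => (h4 p a ha).trans h⟩

theorem regs_world_mono (R : Reg S) : Monotone fun k => ((r.world k).regs R).1 :=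
  monotone_nat_of_le_succ fun k => (r.trans_world k).regs_mono (r.basic_world k) R

theorem inOp_of_call {s : ℕ} {p : Fin n} {op : Op V} (hs : r.ev s = .call p op) :
    ∀ j, s < j → (∀ i, s < i → i < j → ∀ v, r.ev i ≠ .ret p v) →
      (r.world j).InOp t p ((r.world (s + 1)).state p).round
        ((r.world (s + 1)).state p).pair.1 (r.world s).regs := by
  intro j hj
  induction j, Nat.succ_le_of_lt hj using Nat.le_induction with
  | base =>
    intro _
    have h := r.trans_world s
    obtain ⟨-, h1, h2⟩ := (hs ▸ h : Trans t w (r.world s) (.call p op) (r.world (s + 1))).of_call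
    refine Or.inl ⟨by simp [h1], rfl, ?_⟩
    rw [show ((r.world (s + 1)).state p).round = ((r.world s).state p).round + 1 by simp [h1]]
    exact (h.below (r.below_world s p) le_rfl).inRound le_rfl fun R => by rw [h2]
  | succ j hj' ih =>
    intro hi
    exact (r.trans_world j).inOp (r.basic_world j) (r.below_world j p)
      (ih hj' fun i h1 h2 => hi i h1 (by omega)) (hi j hj' (Nat.lt_succ_self j))

theorem Returns.exists_stored {s f : ℕ} {v : V} (h : r.Returns s f v) :
    ∃ p op, r.ev s = .call p op ∧ s < f ∧ v = ((r.world f).state p).res.2 ∧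
      ((r.world (s + 1)).state p).pair.1 ≤ ((r.world f).state p).res.1 ∧
      Gathered t ((r.world f).state p).res.1 (r.world s).regs ∧
      Stored t ((r.world f).state p).res.1 (r.world f).regs := by
  obtain ⟨p, op, hs, hsf, hf, hmin⟩ := h
  have ht := r.trans_world f
  obtain ⟨h1, h2, h3, -⟩ := (hf ▸ ht : Trans t w (r.world f) (.ret p v) (r.world (f + 1))).of_ret
  exact ⟨p, op, hs, hsf, h3, (r.inOp_of_call hs f hsf hmin).stored h1 h2⟩

/-- A stored timestamp is found by every later operation. -/
theorem le_of_stored_of_gathered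
    (hS : ∀ P P' : Finset (Fin n), n - t ≤ P.card → n - t ≤ P'.card →
      ∃ i, ∃ u ∈ P, ∃ v ∈ P', u ∈ S i ∧ v ∈ S i)
    {f s x y : ℕ} (hfs : f ≤ s) (hx : Stored t x (r.world f).regs)
    (hy : Gathered t y (r.world s).regs) : x ≤ y := by
  obtain ⟨P, hP, hx⟩ := hx
  obtain ⟨P', hP', hy⟩ := hy
  obtain ⟨i, u, hu, v, hv, hui, hvi⟩ := hS P P' hP hP'
  exact (hx ⟨(i, u), hui⟩ hu).trans ((r.regs_world_mono _ hfs).trans (hy v hv ⟨(i, u), hui⟩ hvi))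

open Classical in
/-- The number of writes that start before time `k`. -/
noncomputable def writes (k : ℕ) : ℕ := Nat.count (fun s => ∃ v, r.IsWrite s v) k

/-- A write that starts at `s` has index `writes (s + 1)`, since `writes` counts strictly earlier
starts and the write itself must be included. -/
theorem writes_eq_ncard (s : ℕ) :
    r.writes (s + 1) = {s' : ℕ | s' ≤ s ∧ ∃ v', r.IsWrite s' v'}.ncard := by
  classical
  rw [writes, Nat.count_eq_card_filter_range, ← Set.ncard_coe_finset]
  congr 1
  ext x
  simp

theorem writes_mono : Monotone r.writes := by
  classical exact Nat.count_monotone _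

/-- The pair `y` is initial, or it was written before time `k`. -/
def Valid (k : ℕ) (y : ℕ × V) : Prop :=
  (y.1 = 0 ∧ y.2 = v₀) ∨ ∃ s < k, r.IsWrite s y.2 ∧ y.1 = r.writes (s + 1)

theorem Valid.mono {k k' : ℕ} (hk : k ≤ k') {y : ℕ × V} (h : r.Valid k y) : r.Valid k' y := by
  rcases h with h | ⟨s, hs, h⟩
  · exact Or.inl h
  · exact Or.inr ⟨s, hs.trans_le hk, h⟩

theorem Valid.le_writes {k : ℕ} {y : ℕ × V} (h : r.Valid k y) : y.1 ≤ r.writes k := by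
  rcases h with ⟨h, -⟩ | ⟨s, hs, -, h⟩
  · omega
  · rw [h]
    exact r.writes_mono hs

theorem pair_afterCall_of_isWrite {s : ℕ} {p : Fin n} {v : V} (hs : r.ev s = .call p (.write v)) :
    p = w ∧ ((r.world (s + 1)).state w).pair.1 = ((r.world s).state w).pair.1 + 1 := by
  have h := r.trans_world s
  obtain ⟨h1, h2, -⟩ :=
    (hs ▸ h : Trans t w (r.world s) (.call p (.write v)) (r.world (s + 1))).of_call
  obtain rfl := h1 v rfl
  exact ⟨rfl, by rw [h2]; rfl⟩

/-- Both claims need each other. A new write gets the right index because the timestamp of `w`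
equals the number of writes so far. Conversely, that timestamp cannot be larger because the pair of
`w` is valid, nor smaller because timestamps never decrease and each write adds one. -/
theorem valid_world (k : ℕ) :
    (r.world k).AllPairs (r.Valid k) ∧ ((r.world k).state w).pair.1 = r.writes k := by
  induction k with
  | zero =>
    rw [world_zero]
    refine ⟨⟨fun p => Or.inl ⟨rfl, rfl⟩, fun p => Or.inl ⟨rfl, rfl⟩, by simp [World.initial],
      fun R => Or.inl ⟨rfl, rfl⟩⟩, ?_⟩
    simp [World.initial, writes]
  | succ k ih =>
    obtain ⟨⟨h1, h2, h3, h4⟩, h5⟩ := ih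
    have hm : ∀ {y}, r.Valid k y → r.Valid (k + 1) y := fun h => Valid.mono r (Nat.le_succ k) h
    have hwk : ∀ v, r.IsWrite k v → r.writes (k + 1) = r.writes k + 1 := by
      intro v hv
      classical
      rw [writes, Nat.count_succ, if_pos ⟨v, hv⟩, writes]
    have hall : (r.world (k + 1)).AllPairs (r.Valid (k + 1)) := by
      refine (r.trans_world k).allPairs ⟨fun p => hm (h1 p), fun p => hm (h2 p),
        fun x hx => hm (h3 x hx), fun R => hm (h4 R)⟩ fun p v he => Or.inr ⟨k, by omega, ⟨p, he⟩, ?_⟩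
      obtain ⟨rfl, -⟩ := r.pair_afterCall_of_isWrite he
      rw [hwk v ⟨p, he⟩, h5]
    refine ⟨hall, le_antisymm (Valid.le_writes r (hall.pair w)) ?_⟩
    by_cases hk : ∃ v, r.IsWrite k v
    · obtain ⟨v, hv⟩ := hk
      obtain ⟨p, hp⟩ := id hv
      rw [hwk v hv, (r.pair_afterCall_of_isWrite hp).2, h5]
    · refine le_trans ?_ (h5 ▸ (r.trans_world k).pair_mono w)
      classical
      rw [writes, Nat.count_succ, if_neg hk, writes]
      simp

theorem Returns.unique {s f f' : ℕ} {v v' : V} (h : r.Returns s f v) (h' : r.Returns s f' v') :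
    f = f' := by
  obtain ⟨p, op, hs, hsf, hf, hmin⟩ := h
  obtain ⟨p', op', hs', hsf', hf', hmin'⟩ := h'
  rw [hs] at hs'
  cases hs'
  rcases lt_trichotomy f f' with h | h | h
  · exact absurd hf (hmin' f hsf h v)
  · exact h
  · exact absurd hf' (hmin f' hsf' h v')

/-- The timestamp of an operation is at least the one of every write that precedes it. -/
theorem writes_le_of_precedes
    (hS : ∀ P P' : Finset (Fin n), n - t ≤ P.card → n - t ≤ P'.card →
      ∃ i, ∃ u ∈ P, ∃ v ∈ P', u ∈ S i ∧ v ∈ S i)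
    {o s : ℕ} {v : V} (ho : r.IsWrite o v) (hos : r.Precedes o s) {y : ℕ}
    (hy : Gathered t y (r.world s).regs) : r.writes (o + 1) ≤ y := by
  obtain ⟨f, x, hf, hfs⟩ := hos
  obtain ⟨p, op, hp, -, -, h1, -, h2⟩ := Returns.exists_stored r hf
  obtain ⟨p', hp'⟩ := ho
  rw [hp'] at hp
  cases hp
  obtain ⟨rfl, -⟩ := r.pair_afterCall_of_isWrite hp'
  rw [(r.valid_world (o + 1)).2] at h1
  exact h1.trans (r.le_of_stored_of_gathered hS hfs.le h2 hy)

/-- The returned timestamp dominates that of every write preceding the read. If it is `0`, there is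
no such write. Otherwise it is the index of a write `o`, and a write between `o` and the read would
have a larger index. -/
theorem property1_protocol
    (hS : ∀ P P' : Finset (Fin n), n - t ≤ P.card → n - t ≤ P'.card →
      ∃ i, ∃ u ∈ P, ∃ v ∈ P', u ∈ S i ∧ v ∈ S i) : r.Property1 v₀ := by
  classical
  intro s f v _ hret
  obtain ⟨p, op, -, hsf, hv, -, hgath, -⟩ := Returns.exists_stored r hret
  have hpos : ∀ o v', r.IsWrite o v' → r.writes o < r.writes (o + 1) := fun o v' ho =>
    Nat.count_strict_mono ⟨v', ho⟩ (Nat.lt_succ_self o)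
  rcases (r.valid_world f).1.res p with ⟨h1, h2⟩ | ⟨o, hof, ho, h2⟩
  · refine Or.inr ⟨?_, hv.trans h2⟩
    rintro ⟨o, v', ho, hos⟩
    have h3 := r.writes_le_of_precedes hS ho hos hgath
    have h4 := hpos o v' ho
    omega
  · left
    rw [hv]
    refine ⟨o, ho, ?_⟩
    by_cases hos : r.Precedes o s
    · refine Or.inl ⟨hos, ?_⟩
      rintro ⟨o', v', ho', ⟨f', x, ⟨p', op', -, h5, -, -⟩, hf'⟩, ho's⟩
      have h3 := r.writes_le_of_precedes hS ho' ho's hgath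
      have h4 := hpos o' v' ho'
      have h6 := r.writes_mono (show o + 1 ≤ o' by omega)
      omega
    -- The write started before the read returned, so the read cannot precede it.
    · refine Or.inr ⟨hos, ?_⟩
      rintro ⟨f', x, hret', hf'⟩
      have := Returns.unique r hret hret'
      omega

/-- Distinctness of the written values lets the value determine the index, so that indices can be
compared as timestamps. -/
theorem Valid.eq_of_isValue {k j : ℕ} {y : ℕ × V} (hd : r.DistinctWrites v₀) (hy : r.Valid k y)
    (hj : r.IsValue v₀ j y.2) : j = y.1 := by
  rcases hy with ⟨h1, h2⟩ | ⟨s, -, hs, h2⟩ <;> rcases hj with ⟨h3, h4⟩ | ⟨s', hs', h4⟩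
  · omega
  · obtain ⟨p, hp⟩ := hs'
    exact absurd h2 (hd s' p _ hp).1
  · obtain ⟨p, hp⟩ := hs
    exact absurd h4 (hd s p _ hp).1
  · obtain ⟨p, hp⟩ := hs
    obtain ⟨p', hp'⟩ := hs'
    obtain rfl := (hd s p _ hp).2 s' p' hp'
    rw [h2, h4, writes_eq_ncard]

/-- The earlier read stored its timestamp in its second round before returning, so the later read
gathers it. -/
theorem property2_protocol
    (hS : ∀ P P' : Finset (Fin n), n - t ≤ P.card → n - t ≤ P'.card →
      ∃ i, ∃ u ∈ P, ∃ v ∈ P', u ∈ S i ∧ v ∈ S i) (hd : r.DistinctWrites v₀) :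
    r.Property2 v₀ := by
  rintro s f v s' f' v' k k' - hret - hret' hk hk' ⟨f₁, x, hret₁, hf₁⟩
  obtain rfl := Returns.unique r hret hret₁
  obtain ⟨p, op, -, -, hv, -, -, hstored⟩ := Returns.exists_stored r hret
  obtain ⟨p', op', -, -, hv', -, hgath, -⟩ := Returns.exists_stored r hret'
  rw [hv] at hk
  rw [hv'] at hk'
  rw [Valid.eq_of_isValue r hd ((r.valid_world f).1.res p) hk,
    Valid.eq_of_isValue r hd ((r.valid_world f').1.res p') hk']
  exact r.le_of_stored_of_gathered hS hf₁.le hstored hgath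

end Run

end Atomicity
-- Liveness: correct processes keep answering, so every round is completed.
section Liveness

variable {n m : ℕ} {S : Fin m → Set (Fin n)} {V : Type u}
variable {t : ℕ} {w : Fin n} {W W' : World S V} {e : Event n V (Packet V)}

theorem Trans.seen_mono (h : Trans t w W e W') (p q : Fin n) :
    (W.state p).seen q ≤ (W'.state p).seen q := by
  cases h with
  | idle => rfl
  | recvSome p' q' a net h hc hnet =>
    simp only [Function.update_apply]
    split_ifs with hh
    · subst hh
      rw [seen_afterRecv_some]
      split_ifs with hh
      · subst hh
        exact le_max_left _ _
      · rfl
    · rfl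
  | _ =>
    simp only [Function.update_apply]
    split_ifs with hh
    · subst hh
      simp
    · rfl

theorem Trans.acked_mono (h : Trans t w W e W') (p q : Fin n) :
    (W.state p).acked q ≤ (W'.state p).acked q := by
  cases h with
  | idle => rfl
  | recvSome p' q' a net h hc hnet =>
    simp only [Function.update_apply]
    split_ifs with hh
    · subst hh
      rw [acked_afterRecv_some]
      split_ifs with hh
      · subst hh
        exact le_max_left _ _
      · rfl
    · rfl
  | _ =>
    simp only [Function.update_apply]
    split_ifs with hh
    · subst hh
      simp
    · rfl

theorem Trans.of_recv {p q : Fin n} {a : Packet V} (h : Trans t w W (.recv p (some (q, a))) W') :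
    a.round ≤ (W'.state p).seen q ∧ a.ack ≤ (W'.state p).acked q := by
  cases h with
  | recvSome _ _ _ net h hc hnet => simp

theorem Trans.of_not_isStepOf (h : Trans t w W e W') {p : Fin n} (he : ¬ e.IsStepOf p) :
    (W'.state p).todo = (W.state p).todo ∧
      ((W'.state p).left = (W.state p).left ∨ (W'.state p).left = 2) := by
  cases h with
  | idle => exact ⟨rfl, Or.inl rfl⟩
  | call p' op hw hb =>
    by_cases hp : p = p'
    · subst hp
      simp [todo_afterCall]
    · simp [hp]
  | _ =>
    simp only [Event.IsStepOf] at he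
    simp [Ne.symm he]

theorem Trans.of_isStepOf_cons (h : Trans t w W e W') {p : Fin n} (he : e.IsStepOf p)
    {a : Instr S} {l : List (Instr S)} (hl : (W.state p).todo = a :: l) :
    (W'.state p).todo = l ∧ ∀ q, a = .send q → (p, q, (W.state p).packet q) ∈ W'.net := by
  cases h with
  | idle => exact he.elim
  | call => exact he.elim
  | _ =>
    obtain rfl := he
    simp_all

theorem Trans.of_isStepOf_nil (h : Trans t w W e W') {p : Fin n} (he : e.IsStepOf p)
    (hl : (W.state p).todo = []) :
    ((W.state p).left = 1 ∧ (W.state p).Complete t ∧ (∃ v, e = .ret p v) ∧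
      (W'.state p).todo = [] ∧ (W'.state p).left = 0) ∨
    (¬ ((W.state p).left = 1 ∧ (W.state p).Complete t) ∧ (∃ o, e = .recv p o) ∧
      (W'.state p).todo = program S p ∧ (W'.state p).left = ((W.state p).advance t).left) := by
  cases h with
  | idle => exact he.elim
  | call => exact he.elim
  | recvNone p' h hc =>
    obtain rfl := he
    exact Or.inr ⟨hc, ⟨_, rfl⟩, by simp [todo_afterRecv], by simp⟩
  | recvSome p' q a net h hc hnet =>
    obtain rfl := he
    exact Or.inr ⟨hc, ⟨_, rfl⟩, by simp [todo_afterRecv], by simp⟩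
  | ret p' h hl' hc =>
    obtain rfl := he
    exact Or.inl ⟨hl', hc, ⟨_, rfl⟩, by simp [h], by simp⟩
  | _ =>
    obtain rfl := he
    simp_all

namespace Run

theorem Correct.exists_step {A : Algorithm S V} {r : Run A w} {p : Fin n} (hp : r.Correct p)
    {P : ℕ → Prop} (hP : ∀ i, P i → ¬ (r.ev i).IsStepOf p → P (i + 1)) {j : ℕ} (hj : P j) :
    ∃ j' ≥ j, P j' ∧ (r.ev j').IsStepOf p := by
  obtain ⟨k, hk, hs⟩ := hp j
  obtain ⟨d, rfl⟩ := Nat.exists_eq_add_of_le hk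
  clear hk
  induction d generalizing j with
  | zero => exact ⟨j, le_rfl, hj, hs⟩
  | succ d ih =>
    by_cases h : (r.ev j).IsStepOf p
    · exact ⟨j, le_rfl, hj, h⟩
    · obtain ⟨j', h1, h2⟩ := ih (hP j hj h) (by rwa [add_assoc, add_comm 1])
      exact ⟨j', by omega, h2⟩

variable {v₀ : V} {r : Run (protocol S t v₀) w} {p q : Fin n}

theorem Correct.exists_step_todo (hp : r.Correct p) (j : ℕ) :
    ∃ j' ≥ j, ((r.world j').state p).todo = ((r.world j).state p).todo ∧ (r.ev j').IsStepOf p :=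
  hp.exists_step (P := fun i => ((r.world i).state p).todo = ((r.world j).state p).todo)
    (fun i h1 h2 => ((r.trans_world i).of_not_isStepOf h2).1.trans h1) rfl

theorem Correct.exists_step_nil (hp : r.Correct p) (j : ℕ) :
    ∃ j' ≥ j, ((r.world j').state p).todo = [] ∧ (r.ev j').IsStepOf p := by
  induction h : ((r.world j).state p).todo generalizing j with
  | nil =>
    obtain ⟨j', h1, h2, h3⟩ := hp.exists_step_todo j
    exact ⟨j', h1, h2.trans h, h3⟩
  | cons a l ih =>
    obtain ⟨j', h1, h2, h3⟩ := hp.exists_step_todo j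
    obtain ⟨k, hk, h4⟩ :=
      ih (j' + 1) ((r.trans_world j').of_isStepOf_cons h3 (h2.trans h)).1
    exact ⟨k, by omega, h4⟩

/-- An empty program leads to a return or to an attempt to receive. After a return `left` is `0`,
and a call can only set it to `2`, so the next step is no return. Hence a correct process tries to
receive infinitely often, as `ReliableLinks` demands. -/
theorem Correct.exists_recv (hp : r.Correct p) (j : ℕ) :
    ∃ j' ≥ j, (∃ o, r.ev j' = .recv p o) ∧ ((r.world (j' + 1)).state p).todo = program S p := by
  obtain ⟨j₁, hj₁, h1, h2⟩ := hp.exists_step_nil j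
  rcases (r.trans_world j₁).of_isStepOf_nil h2 h1 with ⟨-, -, -, h3, h4⟩ | ⟨-, h3, h4, -⟩
  · obtain ⟨j₂, hj₂, ⟨h5, h6⟩, h7⟩ := hp.exists_step (j := j₁ + 1)
      (P := fun i => ((r.world i).state p).todo = [] ∧ ((r.world i).state p).left ≠ 1)
      (fun i h1 h2 => by
        obtain ⟨h3, h4⟩ := (r.trans_world i).of_not_isStepOf h2
        exact ⟨h3.trans h1.1, by have := h1.2; omega⟩) ⟨h3, by omega⟩
    rcases (r.trans_world j₂).of_isStepOf_nil h7 h5 with ⟨h8, -⟩ | ⟨-, h8, h9, -⟩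
    · exact absurd h8 h6
    · exact ⟨j₂, by omega, h8, h9⟩
  · exact ⟨j₁, hj₁, h3, h4⟩

theorem Correct.exists_instr (hp : r.Correct p) {a : Instr S} (ha : a ∈ program S p) (j : ℕ) :
    ∃ j' ≥ j, (r.ev j').IsStepOf p ∧ ∃ l, ((r.world j').state p).todo = a :: l := by
  have key : ∀ j, a ∈ ((r.world j).state p).todo →
      ∃ j' ≥ j, (r.ev j').IsStepOf p ∧ ∃ l, ((r.world j').state p).todo = a :: l := by
    intro j hj
    induction h : ((r.world j).state p).todo generalizing j with
    | nil => simp [h] at hj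
    | cons b l ih =>
      obtain ⟨j', h1, h2, h3⟩ := hp.exists_step_todo j
      rw [h] at h2
      by_cases hab : a = b
      · subst hab
        exact ⟨j', h1, h3, l, h2⟩
      · have h4 := ((r.trans_world j').of_isStepOf_cons h3 h2).1
        rw [h, List.mem_cons, or_iff_right hab] at hj
        obtain ⟨k, hk, h5⟩ := ih (j' + 1) (by rwa [h4]) h4
        exact ⟨k, by omega, h5⟩
  obtain ⟨j₁, h1, -, h2⟩ := hp.exists_recv j
  obtain ⟨k, hk, h3⟩ := key (j₁ + 1) (by rwa [h2])
  exact ⟨k, by omega, h3⟩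

/-- One packet carries both the round of `p` and its acknowledgement for `q`; both bounds thus come
from the same delivery. -/
theorem Correct.exists_delivery (hr : r.ReliableLinks) (hp : r.Correct p) (hq : r.Correct q)
    (j : ℕ) : ∃ j₁ ≥ j, ∃ j₂ ≥ j₁,
      ((r.world j₁).state p).round ≤ ((r.world j₂).state q).seen p ∧
      ((r.world j₁).state p).seen q ≤ ((r.world j₂).state q).acked p := by
  obtain ⟨j₁, h1, h2, l, h3⟩ := hp.exists_instr (send_mem_program (q := q)) j
  have h4 := ((r.trans_world j₁).of_isStepOf_cons h2 h3).2 q rfl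
  obtain ⟨j₂, h5, h6⟩ := hr q (fun k => by
    obtain ⟨k', h1, h2, -⟩ := hq.exists_recv k
    exact ⟨k', h1, h2⟩) (j₁ + 1) p _ h4
  have h7 := r.trans_world j₂
  exact ⟨j₁, h1, j₂ + 1, by omega, (h6 ▸ h7 : Trans t w (r.world j₂)
    (.recv q (some (p, ((r.world j₁).state p).packet q))) (r.world (j₂ + 1))).of_recv⟩

theorem round_world_mono (p : Fin n) : Monotone fun k => ((r.world k).state p).round :=
  monotone_nat_of_le_succ fun k => (r.trans_world k).round_mono p

theorem seen_world_mono (p q : Fin n) : Monotone fun k => ((r.world k).state p).seen q :=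
  monotone_nat_of_le_succ fun k => (r.trans_world k).seen_mono p q

theorem acked_world_mono (p q : Fin n) : Monotone fun k => ((r.world k).state p).acked q :=
  monotone_nat_of_le_succ fun k => (r.trans_world k).acked_mono p q

theorem Correct.eventually_acked (hr : r.ReliableLinks) (hp : r.Correct p) (hq : r.Correct q)
    (j : ℕ) : ∀ᶠ k in Filter.atTop,
      ((r.world j).state p).round ≤ ((r.world k).state p).acked q := by
  -- The round number travels to `q`, and the acknowledgement then travels back.
  obtain ⟨j₁, h1, j₂, -, h2, -⟩ := hp.exists_delivery hr hq j
  obtain ⟨j₃, h3, j₄, -, -, h4⟩ := hq.exists_delivery hr hp j₂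
  filter_upwards [Filter.eventually_ge_atTop j₄] with k hk
  exact ((r.round_world_mono p h1).trans h2).trans
    (((r.seen_world_mono q p h3).trans h4).trans (r.acked_world_mono p q hk))

/-- Every round of an operation is completed. -/
theorem Correct.exists_complete (hr : r.ReliableLinks) (hc : r.crashed.ncard ≤ t)
    (hp : r.Correct p) {j : ℕ} (hj : ((r.world j).state p).left ≠ 0) :
    ∃ j' ≥ j, (r.ev j').IsStepOf p ∧ ((r.world j').state p).todo = [] ∧
      ((r.world j').state p).Complete t ∧
      ((r.world j').state p).left = ((r.world j).state p).left := by
  classical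
  by_contra! hcon
  -- While the round is not completed, `left` and `round` are frozen, so acknowledgements of the
  -- round number at time `j` keep counting.
  have hconst : ∀ d, ((r.world (j + d)).state p).left = ((r.world j).state p).left ∧
      ((r.world (j + d)).state p).round = ((r.world j).state p).round := by
    intro d
    induction d with
    | zero => exact ⟨rfl, rfl⟩
    | succ d ih =>
      have ht := r.trans_world (j + d)
      rcases ht.left_cases (r.basic_world _) (q := p) (by rw [ih.1]; exact hj) (fun v hv => by
        have hs : (r.ev (j + d)).IsStepOf p := by rw [hv]; rfl
        rw [hv] at ht
        obtain ⟨-, h1, -, h2⟩ := ht.of_ret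
        exact hcon (j + d) (by omega) hs h2 h1 ih.1) with ⟨h1, h2, -⟩ | ⟨-, h1, -, -, -, h2, h3⟩
      · exact ⟨h1.trans ih.1, h2.trans ih.2⟩
      · exact absurd ih.1 (hcon (j + d) (by omega) h3 h2 h1)
  have hev : ∀ᶠ k in Filter.atTop, ∀ q, r.Correct q →
      ((r.world j).state p).round ≤ ((r.world k).state p).acked q := by
    rw [Filter.eventually_all]
    intro q
    by_cases hq : r.Correct q
    · filter_upwards [hp.eventually_acked hr hq j] with k hk _
      exact hk
    · exact Filter.Eventually.of_forall fun k h => absurd h hq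
  obtain ⟨k, hk, hkj⟩ := (hev.and (Filter.eventually_ge_atTop j)).exists
  obtain ⟨k', hk', h1, h2⟩ := hp.exists_step_nil k
  obtain ⟨d, rfl⟩ := Nat.exists_eq_add_of_le (hkj.trans hk')
  refine hcon (j + d) (by omega) h2 h1 ?_ (hconst d).1
  have hcard : n - t ≤ (Finset.univ.filter fun q => r.Correct q).card := by
    have h3 : r.crashed.ncard + (r.crashed)ᶜ.ncard = n := by
      rw [Set.ncard_add_ncard_compl]
      simp
    have h4 : (r.crashed)ᶜ = ((Finset.univ.filter fun q => r.Correct q : Finset (Fin n)) :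
        Set (Fin n)) := by
      ext q
      simp [crashed]
    rw [h4, Set.ncard_coe_finset] at h3
    omega
  refine hcard.trans (Finset.card_le_card fun q hq => ?_)
  simp only [Finset.mem_filter, Finset.mem_univ, true_and] at hq ⊢
  rw [(hconst d).2]
  exact (hk q hq).trans (r.acked_world_mono p q hk')

theorem live_protocol (hr : r.ReliableLinks) (hc : r.crashed.ncard ≤ t) : r.Live := by
  classical
  intro s p op hs hp
  have h := r.trans_world s
  obtain ⟨-, h1, -⟩ := (hs ▸ h : Trans t w (r.world s) (.call p op) (r.world (s + 1))).of_call
  have h2 : ((r.world (s + 1)).state p).left = 2 := by simp [h1]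
  obtain ⟨j₁, hj₁, h3, h4, h5, h6⟩ := hp.exists_complete hr hc (j := s + 1) (by omega)
  have h7 : ((r.world (j₁ + 1)).state p).left = 1 := by
    rcases (r.trans_world j₁).of_isStepOf_nil h3 h4 with ⟨h7, -⟩ | ⟨-, -, -, h7⟩
    · omega
    · rw [h7, Local.advance, if_pos ⟨h6.trans h2, h5⟩]
  obtain ⟨j₂, hj₂, h8, h9, h10, h11⟩ := hp.exists_complete hr hc (j := j₁ + 1) (by omega)
  -- The two completed rounds yield some return after `s`; the first such return is the one that
  -- belongs to the operation.
  have hret : ∃ f, s < f ∧ ∃ v, r.ev f = .ret p v := by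
    rcases (r.trans_world j₂).of_isStepOf_nil h8 h9 with ⟨-, -, h12, -⟩ | ⟨h12, -⟩
    · exact ⟨j₂, by omega, h12⟩
    · exact absurd ⟨h11.trans h7, h10⟩ h12
  obtain ⟨hsf, v, hv⟩ := Nat.find_spec hret
  exact ⟨Nat.find hret, v, p, op, hs, hsf, hv,
    fun j h12 h13 v' h14 => Nat.find_min hret h13 ⟨h12, v', h14⟩⟩

end Run

theorem implementable_of_le_tL {n m : ℕ} {S : Fin m → Set (Fin n)} (hS : ∀ p, ∃ i, p ∈ S i)
    {t : ℕ} (ht : t ≤ tL S) (w : Fin n) {V : Type u} (v₀ : V) : Implementable S t w v₀ := by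
  have hn : 0 < n := Nat.lt_of_le_of_lt (Nat.zero_le _) w.2
  have hQ := fun (P P' : Finset (Fin n)) (hP : n - t ≤ P.card) (hP' : n - t ≤ P'.card) =>
    exists_common_of_le_tL hn hS ht hP hP'
  exact ⟨protocol S t v₀, fun r hr hd hc =>
    ⟨r.property1_protocol hQ, r.property2_protocol hQ hd, Run.live_protocol hr hc⟩⟩

end Liveness
end MM

theorem theorem5 {n : ℕ} (hn : 0 < n) (G : SimpleGraph (Fin n)) :
    MM.tG G = MM.tL (MM.closedNbhd G) ∧
    (∀ t : ℕ, t ≤ MM.tG G → ∀ (w : Fin n) (V : Type u) (v₀ : V),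
      MM.Implementable (MM.closedNbhd G) t w v₀) ∧
    (MM.tG G < n - 1 → ∀ t : ℕ, MM.tG G < t → ∃ w : Fin n, ∀ (V : Type u) [Nontrivial V] (v₀ : V),
      ¬ MM.Implementable (MM.closedNbhd G) t w v₀) := by
  have hS : ∀ p, ∃ i, p ∈ MM.closedNbhd G i := fun p => ⟨p, Set.mem_insert p _⟩
  rw [MM.tG_eq_tL]
  exact ⟨rfl, fun t ht w V v₀ => MM.implementable_of_le_tL hS ht w v₀,
    fun hlt t ht => MM.exists_not_implementable hS hlt ht⟩
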